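/- Let $\mathbb F_q$ be a finite field, let $n,k$ be integers with $1\le k\le n$, let $V$ be a vector space of dimension $2n$ over $\mathbb F_q$, and let $\sigma$ be a non-degenerate alternating bilinear form on $V$. Let $\Lambda_{n,k}$ be the set of $k$-dimensional totally $\sigma$-isotropic subspaces of $V$, and let $\mathbb L\subseteq \mathrm{PG}(\bigwedge^k V)$ be its image under the Plücker embedding $\langle v_1,\dots,v_k\rangle\mapsto\langle v_1\wedge\cdots\wedge v_k\rangle$. Let $\langle\mathbb L\rangle\subseteq\bigwedge^kV$ be the vector subspace spanned by $\mathbb L$. The symplectic Grassmann code $\mathcal W(n,k)$ is the projective code determined by $\mathbb L$: the row space of a matrix whose columns are the coordinate vectors, with respect to a basis of $\langle\mathbb L\rangle$, of the points of $\mathbb L$, each point being taken exactly once. Different orderings of the points, vectors representing them, and bases give equivalent codes. Such a code exists, and, for every choice of ordering, representing vectors and basis, $\mathcal W(n,k)$ has length $$N=\#\mathbb L=\#\Lambda_{n,k}=\prod_{i=0}^{k-1}\frac{q^{2n-2i}-1}{q^{i+1}-1}$$ and dimension $$K=\dim\langle\mathbb L\rangle=\binom{2n}{k}-\binom{2n}{k-2},$$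 where $\binom{m}{j}=0$ for $j<0$. -/

import Mathlib

namespace SymplecticGrassmann

open scoped LinearAlgebra.Projectivization

section Plucker

variable {F V : Type*} [Field F] [AddCommGroup V] [Module F V]

/-- The points of the `k`-Grassmannian of `V`: the subspaces of `V` of dimension `k`. -/
abbrev Grassmannian (F V : Type*) [Field F] [AddCommGroup V] [Module F V] (k : ℕ) : Type _ :=
  {W : Submodule F V // Module.finrank F W = k}

theorem wedge_ne_zero {k : ℕ} {v : Fin k → V} (hv : LinearIndependent F v) :
    exteriorPower.ιMulti F k v ≠ 0 := by
  have h := exteriorPower.ιMulti_family_linearIndependent_field (n := k) hv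
  have h2 := h.ne_zero (Set.powersetCard.ofFinEmbEquiv (RelEmbedding.refl (· ≤ ·)))
  simpa [exteriorPower.ιMulti_family] using h2

variable [FiniteDimensional F V]

/-- A chosen basis of a `k`-dimensional subspace, as a family of vectors of `V`. -/
noncomputable def chosenBasis {k : ℕ} (W : Grassmannian F V k) : Fin k → V :=
  fun i => (Module.finBasisOfFinrankEq F W.1 W.2 i : V)

theorem linearIndependent_chosenBasis {k : ℕ} (W : Grassmannian F V k) :
    LinearIndependent F (chosenBasis W) :=
  (Module.finBasisOfFinrankEq F W.1 W.2).linearIndependent.map' W.1.subtype (by simp)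

/-- The Plücker embedding, sending `⟨v₁, …, vₖ⟩` to the point `⟨v₁ ∧ ⋯ ∧ vₖ⟩` of `PG(⋀ᵏ V)`.
By `plucker_eq` the point does not depend on the basis `v₁, …, vₖ`. -/
noncomputable def plucker (k : ℕ) (W : Grassmannian F V k) : ℙ F (⋀[F]^k V) :=
  Projectivization.mk F (exteriorPower.ιMulti F k (chosenBasis W))
    (wedge_ne_zero (linearIndependent_chosenBasis W))

theorem plucker_eq {k : ℕ} (W : Grassmannian F V k) (v : Fin k → V)
    (hv : LinearIndependent F v) (hW : Submodule.span F (Set.range v) = W.1) :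
    plucker k W = Projectivization.mk F (exteriorPower.ιMulti F k v) (wedge_ne_zero hv) := by
  obtain ⟨W, hk⟩ := W
  subst hW
  symm
  rw [plucker, Projectivization.mk_eq_mk_iff']
  set e := Module.finBasisOfFinrankEq F (Submodule.span F (Set.range v)) hk with he
  let g := (exteriorPower.ιMulti F k (M := V)).compLinearMap
    (Submodule.span F (Set.range v)).subtype
  have key : g = (LinearMap.toSpanSingleton F _ (g e)).compAlternatingMap e.det := by
    refine Module.Basis.ext_alternating e fun i h => ?_
    let s : Equiv.Perm (Fin k) := Equiv.ofBijective i (Finite.injective_iff_bijective.1 h)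
    change g (e ∘ s) = (LinearMap.toSpanSingleton F _ (g e)).compAlternatingMap e.det (e ∘ s)
    simp [AlternatingMap.map_perm, Module.Basis.det_self]
  let v' : Fin k → Submodule.span F (Set.range v) := fun i =>
    ⟨v i, Submodule.subset_span ⟨i, rfl⟩⟩
  refine ⟨e.det v', ?_⟩
  have := congrArg (fun f => f v') key
  exact this.symm

/-- The point set of the symplectic `k`-Grassmannian: the `k`-subspaces of `V` on which the
form `σ` vanishes identically. -/
def symplecticGrassmannian (σ : LinearMap.BilinForm F V) (k : ℕ) : Set (Grassmannian F V k) :=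
  {W | ∀ x ∈ W.1, ∀ y ∈ W.1, σ x y = 0}

/-- The image of the symplectic `k`-Grassmannian under the Plücker embedding. -/
def pluckerImage (σ : LinearMap.BilinForm F V) (k : ℕ) : Set (ℙ F (⋀[F]^k V)) :=
  plucker k '' symplecticGrassmannian σ k

end Plucker

section Codes

variable {F U : Type*} [Field F] [AddCommGroup U] [Module F U]

/-- The vector subspace of `U` underlying the projective span of a set of points of `PG(U)`. -/
def linearSpan (Ω : Set (ℙ F U)) : Submodule F U :=
  Projectivization.Subspace.submodule (Projectivization.Subspace.span Ω)

/-- `G` is a generator matrix of the projective system `Ω` of `PG(⟨Ω⟩)`: for some ordering of the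
points of `Ω`, some choice of vectors representing them, and some basis of `⟨Ω⟩`, the columns
of `G` are the coordinate vectors of the points of `Ω`, each point occurring exactly once. -/
def IsGeneratorMatrix (Ω : Set (ℙ F U)) {m N : ℕ} (G : Matrix (Fin m) (Fin N) F) : Prop :=
  ∃ (p : Fin N ≃ Ω) (b : Module.Basis (Fin m) F (linearSpan Ω)) (r : Fin N → linearSpan Ω),
    (∀ j, ∃ h : (r j : U) ≠ 0, Projectivization.mk F (r j : U) h = p j) ∧
      ∀ i j, G i j = b.repr (r j) i

/-- The linear code `C` of length `N` is a projective code determined by `Ω`: the row space of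
some generator matrix of `Ω`. -/
def IsCodeOf (Ω : Set (ℙ F U)) {N : ℕ} (C : Submodule F (Fin N → F)) : Prop :=
  ∃ (m : ℕ) (G : Matrix (Fin m) (Fin N) F),
    IsGeneratorMatrix Ω G ∧ C = Submodule.span F (Set.range G.row)

end Codes

/-- `C` is (a representative of) the symplectic Grassmann code `𝒲(n,k)` of the form `σ`. -/
def IsSymplecticGrassmannCode {F V : Type*} [Field F] [AddCommGroup V] [Module F V]
    [FiniteDimensional F V] (σ : LinearMap.BilinForm F V) (k : ℕ) {N : ℕ}
    (C : Submodule F (Fin N → F)) : Prop :=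
  IsCodeOf (pluckerImage σ k) C

/-- The binomial coefficient `m` over `j`, with the convention that it is `0` for `j < 0`. -/
def binom (m : ℕ) (j : ℤ) : ℕ := if 0 ≤ j then m.choose j.toNat else 0

end SymplecticGrassmann

namespace SymplecticGrassmann

open scoped LinearAlgebra.Projectivization

/-! ### Projective systems and their codes: length and dimension. -/

section ProjectiveCodes

variable {F U : Type*} [Field F] [AddCommGroup U] [Module F U]

/-! Length: a subspace is recovered from its Plücker point as the set of `x` with `x ∧ ω = 0`
(`plucker_injective`), so it suffices to count totally isotropic `k`-subspaces. Their ordered bases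
are counted twice: vector by vector (`card_isotropicFrame`) and subspace by subspace
(`card_isotropicFrame_eq_mul`).

Dimension: the code has the dimension of `⟨𝕃⟩`, which inside the exterior algebra is the span of the
products of pairwise orthogonal vectors (`isotropicSpan`). It is bounded from both sides.

Lower bound (`choose_le_finrank_isotropicSpan`): split off a hyperbolic pair `e, f` and let `U'` be
its orthogonal complement in `U`. Writing `d` for the dimension of the isotropic span, contractions
with `e` and `f` give `d(U, k) ≥ d(U', k) + 2 d(U', k-1) + d(U', k-2)`, the recursion obeyed by the
binomial difference.

Upper bound (`finrank_isotropicSpan_add_chooseSubTwo_le`): contraction with the symplectic bivector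
kills every isotropic product. In characteristic zero the `sl₂` relations make its kernel as small
as required, but the argument divides by integers that may vanish in `F`. It is therefore run over
the Witt vectors of `F`, a local principal ideal domain of characteristic zero with residue field
`F`. Isotropic families lift there (`exists_isotropic_lift`), so the isotropic span lies in the
`F`-span of the reduction of the kernel, whose dimension is at most the rank of the kernel. -/

theorem linearSpan_eq_span (Ω : Set (ℙ F U)) :
    linearSpan Ω = Submodule.span F {u | ∃ h : u ≠ 0, Projectivization.mk F u h ∈ Ω} := by
  apply le_antisymm
  · rw [linearSpan, ← OrderIso.le_symm_apply, Projectivization.Subspace.span_le_subspace_iff]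
    intro x hx
    induction x using Projectivization.ind with
    | h v hv => exact Submodule.subset_span ⟨hv, hx⟩
  · rw [Submodule.span_le]
    rintro u ⟨h, hu⟩
    exact (Projectivization.Subspace.mem_submodule_iff _ h).2
      (Projectivization.Subspace.subset_span Ω hu)

theorem linearSpan_le_span_of_rep {Ω : Set (ℙ F U)} {ι : Type*} (r : ι → U)
    (hr : ∀ x ∈ Ω, ∃ (j : ι) (h : r j ≠ 0), Projectivization.mk F (r j) h = x) :
    linearSpan Ω ≤ Submodule.span F (Set.range r) := by
  rw [linearSpan_eq_span, Submodule.span_le]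
  rintro u ⟨h, hu⟩
  obtain ⟨j, hj, e⟩ := hr _ hu
  obtain ⟨a, ha⟩ := (Projectivization.mk_eq_mk_iff' F _ _ h hj).1 e.symm
  rw [← ha]
  exact Submodule.smul_mem _ _ (Submodule.subset_span ⟨j, rfl⟩)

theorem IsCodeOf.length_eq {Ω : Set (ℙ F U)} {N : ℕ} {C : Submodule F (Fin N → F)}
    (h : IsCodeOf Ω C) : N = Ω.ncard := by
  obtain ⟨m, G, ⟨p, -⟩, -⟩ := h
  rw [← Nat.card_coe_set_eq, ← Nat.card_congr p, Nat.card_fin]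

/-- Row rank equals column rank, and the columns are the coordinates of representatives that span
`⟨Ω⟩`. -/
theorem IsCodeOf.finrank_eq {Ω : Set (ℙ F U)} {N : ℕ} {C : Submodule F (Fin N → F)}
    (h : IsCodeOf Ω C) : Module.finrank F C = Module.finrank F (linearSpan Ω) := by
  obtain ⟨m, G, ⟨p, b, r, hr, hG⟩, rfl⟩ := h
  have hspan : Submodule.span F (Set.range r) = ⊤ := by
    apply Submodule.map_injective_of_injective (linearSpan Ω).injective_subtype
    rw [Submodule.map_span, ← Set.range_comp, Submodule.map_top, Submodule.range_subtype]
    apply le_antisymm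
    · rw [Submodule.span_le]
      rintro _ ⟨j, rfl⟩
      exact (r j).2
    · apply linearSpan_le_span_of_rep
      intro x hx
      obtain ⟨h0, h1⟩ := hr (p.symm ⟨x, hx⟩)
      exact ⟨p.symm ⟨x, hx⟩, h0, by simpa using h1⟩
  have hcol : G.col = b.equivFun ∘ r := by
    ext j i
    simp [Matrix.col, hG]
  rw [← Matrix.rank_eq_finrank_span_row, Matrix.rank_eq_finrank_span_cols, hcol, Set.range_comp]
  have : Submodule.span F (b.equivFun '' Set.range r) =
      (Submodule.span F (Set.range r)).map b.equivFun.toLinearMap := by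
    rw [Submodule.map_span]; rfl
  rw [this, hspan, Submodule.map_top, LinearEquiv.range, finrank_top,
    Module.finrank_eq_card_basis b]
  simp

theorem exists_isCodeOf [FiniteDimensional F U] {Ω : Set (ℙ F U)} (hΩ : Ω.Finite) :
    ∃ (N : ℕ) (C : Submodule F (Fin N → F)), IsCodeOf Ω C := by
  have := hΩ.to_subtype
  let p := (Finite.equivFin Ω).symm
  let b := Module.finBasis F (linearSpan Ω)
  have hmem (j) : (p j : ℙ F U).rep ∈ linearSpan Ω := by
    rw [linearSpan_eq_span]
    refine Submodule.subset_span ⟨Projectivization.rep_nonzero _, ?_⟩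
    rw [Projectivization.mk_rep]
    exact (p j).2
  let r : Fin (Nat.card Ω) → linearSpan Ω := fun j => ⟨(p j : ℙ F U).rep, hmem j⟩
  exact ⟨_, _, _, Matrix.of fun i j => b.repr (r j) i,
    ⟨p, b, r, fun j => ⟨Projectivization.rep_nonzero _, Projectivization.mk_rep _⟩,
      fun i j => rfl⟩, rfl⟩

end ProjectiveCodes

/-! ### Injectivity of the Plücker embedding. -/

section PluckerInjective

variable {F V : Type*} [Field F] [AddCommGroup V] [Module F V]

theorem mem_span_iff_ι_mul_ιMulti_eq_zero {k : ℕ} {v : Fin k → V} (hv : LinearIndependent F v)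
    (x : V) : x ∈ Submodule.span F (Set.range v) ↔
      ExteriorAlgebra.ι F x * ExteriorAlgebra.ιMulti F k v = 0 := by
  have e : ExteriorAlgebra.ι F x * ExteriorAlgebra.ιMulti F k v =
      ExteriorAlgebra.ιMulti F (k + 1) (Fin.cons x v) := by
    rw [ExteriorAlgebra.ιMulti_succ_apply]
    simp [Matrix.vecTail, Function.comp_def]
  rw [e]
  constructor
  · intro hx
    apply AlternatingMap.map_linearDependent
    rw [linearIndependent_finCons]
    tauto
  · intro h0
    by_contra hx
    have := wedge_ne_zero (linearIndependent_finCons.2 ⟨hv, hx⟩)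
    exact this (Subtype.ext h0)

variable [FiniteDimensional F V]

theorem span_chosenBasis {k : ℕ} (W : Grassmannian F V k) :
    Submodule.span F (Set.range (chosenBasis W)) = W.1 := by
  have h := (Module.finBasisOfFinrankEq F W.1 W.2).span_eq
  have h2 := congrArg (Submodule.map W.1.subtype) h
  rwa [Submodule.map_span, ← Set.range_comp, Submodule.map_top, Submodule.range_subtype] at h2

theorem plucker_injective (k : ℕ) :
    Function.Injective (plucker k : Grassmannian F V k → ℙ F (⋀[F]^k V)) := by
  intro W W' h
  obtain ⟨a, ha⟩ := (Projectivization.mk_eq_mk_iff' F _ _ _ _).1 h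
  have ha' : a • ExteriorAlgebra.ιMulti F k (chosenBasis W') =
    ExteriorAlgebra.ιMulti F k (chosenBasis W) := congrArg Subtype.val ha
  have ha0 : a ≠ 0 := by
    rintro rfl
    rw [zero_smul] at ha
    exact wedge_ne_zero (linearIndependent_chosenBasis W) ha.symm
  ext x
  rw [← span_chosenBasis W, ← span_chosenBasis W',
    mem_span_iff_ι_mul_ιMulti_eq_zero (linearIndependent_chosenBasis W),
    mem_span_iff_ι_mul_ιMulti_eq_zero (linearIndependent_chosenBasis W'), ← ha', mul_smul_comm,
    smul_eq_zero_iff_right ha0]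

end PluckerInjective

/-! ### The span of the Plücker image inside the exterior algebra. -/

section IsotropicSpan

variable {F V : Type*} [Field F] [AddCommGroup V] [Module F V]

/-- The span of the products `v₁ ∧ ⋯ ∧ vₖ`, where the `vᵢ` are pairwise orthogonal vectors of the
subspace `U`. -/
def isotropicSpan (σ : LinearMap.BilinForm F V) (U : Submodule F V) (k : ℕ) :
    Submodule F (ExteriorAlgebra F V) :=
  Submodule.span F {x | ∃ v : Fin k → V, (∀ i, v i ∈ U) ∧ (∀ i j, σ (v i) (v j) = 0) ∧
    ExteriorAlgebra.ιMulti F k v = x}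

theorem isotropicSpan_le_exteriorPower (σ : LinearMap.BilinForm F V) (U : Submodule F V) (k : ℕ) :
    isotropicSpan σ U k ≤ ⋀[F]^k V := by
  rw [← ExteriorAlgebra.ιMulti_span_fixedDegree]
  apply Submodule.span_mono
  rintro _ ⟨v, -, -, rfl⟩
  exact ⟨v, rfl⟩

/-- The generators of `isotropicSpan` may be dependent families, but these contribute zero; only
genuine frames need checking. -/
theorem isotropicSpan_top_le {σ : LinearMap.BilinForm F V} {k : ℕ}
    {S : Submodule F (ExteriorAlgebra F V)}
    (h : ∀ v : Fin k → V, LinearIndependent F v → (∀ i j, σ (v i) (v j) = 0) →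
      ExteriorAlgebra.ιMulti F k v ∈ S) : isotropicSpan σ ⊤ k ≤ S := by
  refine Submodule.span_le.2 ?_
  rintro _ ⟨v, -, hv, rfl⟩
  by_cases hl : LinearIndependent F v
  · exact h v hl hv
  · rw [AlternatingMap.map_linearDependent _ _ hl]
    exact S.zero_mem

variable [FiniteDimensional F V]

theorem map_linearSpan_pluckerImage (σ : LinearMap.BilinForm F V) (k : ℕ) :
    (linearSpan (pluckerImage σ k)).map (⋀[F]^k V).subtype = isotropicSpan σ ⊤ k := by
  apply le_antisymm
  · have := linearSpan_le_span_of_rep (Ω := pluckerImage σ k)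
      (fun W : symplecticGrassmannian σ k => exteriorPower.ιMulti F k (chosenBasis W.1)) (by
        rintro _ ⟨W, hW, rfl⟩
        exact ⟨⟨W, hW⟩, _, rfl⟩)
    refine (Submodule.map_mono this).trans ?_
    rw [Submodule.map_span, Submodule.span_le]
    rintro _ ⟨_, ⟨W, rfl⟩, rfl⟩
    refine Submodule.subset_span ⟨chosenBasis W.1, fun _ => Submodule.mem_top, fun i j => ?_, rfl⟩
    exact W.2 _ (Subtype.property _) _ (Subtype.property _)
  · apply isotropicSpan_top_le
    intro v hl hv
    refine ⟨exteriorPower.ιMulti F k v, ?_, rfl⟩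
    rw [linearSpan_eq_span]
    refine Submodule.subset_span ⟨wedge_ne_zero hl,
      ⟨⟨Submodule.span F (Set.range v), by simp [finrank_span_eq_card hl]⟩, ?_,
        plucker_eq _ v hl rfl⟩⟩
    intro x hx y hy
    have h1 : Submodule.span F (Set.range v) ≤ LinearMap.ker (σ x) := by
      rw [Submodule.span_le]
      rintro _ ⟨j, rfl⟩
      have h2 : Submodule.span F (Set.range v) ≤ LinearMap.ker (σ.flip (v j)) := by
        rw [Submodule.span_le]
        rintro _ ⟨i, rfl⟩
        simp [hv]
      simpa using h2 hx
    exact h1 hy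

theorem finrank_linearSpan_pluckerImage (σ : LinearMap.BilinForm F V) (k : ℕ) :
    Module.finrank F (linearSpan (pluckerImage σ k)) =
      Module.finrank F (isotropicSpan σ ⊤ k) := by
  rw [← map_linearSpan_pluckerImage]
  exact (Submodule.equivMapOfInjective _ (⋀[F]^k V).injective_subtype _).finrank_eq

end IsotropicSpan

/-! ### Counting totally isotropic subspaces. -/

section Counting

variable {F V : Type*} [Field F] [AddCommGroup V] [Module F V]

/-- The ordered bases of the totally isotropic `k`-subspaces. -/
abbrev IsotropicFrame (σ : LinearMap.BilinForm F V) (k : ℕ) : Type _ :=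
  {v : Fin k → V // LinearIndependent F v ∧ ∀ i j, σ (v i) (v j) = 0}

theorem mem_orthogonal_span_range {σ : LinearMap.BilinForm F V} {ι : Type*} {v : ι → V} {x : V} :
    x ∈ σ.orthogonal (Submodule.span F (Set.range v)) ↔ ∀ i, σ (v i) x = 0 := by
  rw [LinearMap.BilinForm.mem_orthogonal_iff]
  constructor
  · exact fun h i => h _ (Submodule.subset_span ⟨i, rfl⟩)
  · intro h y hy
    have : Submodule.span F (Set.range v) ≤ LinearMap.ker (σ.flip x) := by
      rw [Submodule.span_le]
      rintro _ ⟨i, rfl⟩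
      simpa using h i
    exact this hy

/-- An isotropic frame of length `k + 1` is an isotropic frame of length `k` together with a vector
orthogonal to its span and outside of it. -/
def isotropicFrameSuccEquiv {σ : LinearMap.BilinForm F V} (hσ : σ.IsAlt) (k : ℕ) :
    IsotropicFrame σ (k + 1) ≃ Σ v : IsotropicFrame σ k,
      ((σ.orthogonal (Submodule.span F (Set.range v.1)) : Set V) \
        Submodule.span F (Set.range v.1) : Set V) where
  toFun v := ⟨⟨Fin.tail v.1, (linearIndependent_finCons.1 (by
      rw [Fin.cons_self_tail]; exact v.2.1) : _ ∧ v.1 0 ∉ _).1, fun i j => v.2.2 _ _⟩,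
    ⟨v.1 0, mem_orthogonal_span_range.2 fun i => v.2.2 _ _, (linearIndependent_finCons.1 (by
      rw [Fin.cons_self_tail]; exact v.2.1) : _ ∧ v.1 0 ∉ _).2⟩⟩
  invFun w := ⟨Fin.cons w.2.1 w.1.1, linearIndependent_finCons.2 ⟨w.1.2.1, w.2.2.2⟩, by
    have h := mem_orthogonal_span_range.1 w.2.2.1
    intro i j
    cases i using Fin.cases with
    | zero =>
      cases j using Fin.cases with
      | zero => simpa using hσ _
      | succ j => simpa using hσ.isRefl _ _ (h j)
    | succ i =>
      cases j using Fin.cases with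
      | zero => simpa using h i
      | succ j => simpa using w.1.2.2 i j⟩
  left_inv v := by
    apply Subtype.ext
    exact Fin.cons_self_tail v.1
  right_inv w := by
    obtain ⟨⟨v, hv⟩, ⟨x, hx⟩⟩ := w
    rfl

/-- Comparing the frames in `V` avoids transport along the equality of subspaces. -/
theorem sigma_frame_ext {σ : LinearMap.BilinForm F V} {k : ℕ}
    {W W' : symplecticGrassmannian σ k} (h : W.1.1 = W'.1.1)
    {s : {s : Fin k → W.1.1 // LinearIndependent F s}}
    {s' : {s : Fin k → W'.1.1 // LinearIndependent F s}}
    (hs : ∀ i, (s.1 i : V) = s'.1 i) :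
    (⟨W, s⟩ : Σ W : symplecticGrassmannian σ k, {s : Fin k → W.1.1 // LinearIndependent F s}) =
      ⟨W', s'⟩ := by
  obtain ⟨⟨W, hk⟩, hW⟩ := W
  obtain ⟨⟨W', hk'⟩, hW'⟩ := W'
  obtain ⟨s, hl⟩ := s
  obtain ⟨s', hl'⟩ := s'
  subst h
  obtain rfl : s = s' := funext fun i => Subtype.ext (hs i)
  rfl

variable [FiniteDimensional F V]

/-- An isotropic frame is a totally isotropic subspace with an ordered basis. -/
noncomputable def isotropicFrameEquiv (σ : LinearMap.BilinForm F V) (k : ℕ) :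
    IsotropicFrame σ k ≃ Σ W : symplecticGrassmannian σ k,
      {s : Fin k → W.1.1 // LinearIndependent F s} where
  toFun v := ⟨⟨⟨Submodule.span F (Set.range v.1), by simp [finrank_span_eq_card v.2.1]⟩, by
      have h : Submodule.span F (Set.range v.1) ≤
          σ.orthogonal (Submodule.span F (Set.range v.1)) := by
        rw [Submodule.span_le]
        rintro _ ⟨j, rfl⟩
        exact mem_orthogonal_span_range.2 fun i => v.2.2 i j
      exact fun x hx y hy => h hy x hx⟩,
    ⟨fun i => ⟨v.1 i, Submodule.subset_span ⟨i, rfl⟩⟩,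
      LinearIndependent.of_comp (Submodule.subtype _) v.2.1⟩⟩
  invFun w := ⟨fun i => w.2.1 i, w.2.2.map' (Submodule.subtype _) (by simp),
    fun i j => w.1.2 _ (Subtype.property _) _ (Subtype.property _)⟩
  left_inv v := rfl
  right_inv w := by
    obtain ⟨⟨⟨W, hk⟩, hW⟩, ⟨s, hs⟩⟩ := w
    have hW' : Submodule.span F (Set.range fun i => (s i : V)) = W := by
      have hl : LinearIndependent F fun i => (s i : V) :=
        hs.map' (Submodule.subtype _) (by simp)
      apply Submodule.eq_of_le_of_finrank_eq
      · rw [Submodule.span_le]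
        rintro _ ⟨i, rfl⟩
        exact (s i).2
      · rw [finrank_span_eq_card hl, hk, Fintype.card_fin]
    exact sigma_frame_ext hW' fun i => rfl

variable [Fintype F]

/-- A frame with span `W` of dimension `k` is extended by any vector of `W^⊥ \ W`; here `W ≤ W^⊥`
and `W^⊥` has codimension `k`. -/
theorem card_isotropicFrame {σ : LinearMap.BilinForm F V} (hσ : σ.IsAlt) (hn : σ.Nondegenerate)
    (k : ℕ) : Nat.card (IsotropicFrame σ k) = ∏ i ∈ Finset.range k,
      (Fintype.card F ^ (Module.finrank F V - i) - Fintype.card F ^ i) := by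
  have : Finite V := Module.finite_of_finite F
  induction k with
  | zero =>
    have : Unique (IsotropicFrame σ 0) :=
      ⟨⟨⟨Fin.elim0, linearIndependent_empty_type, fun i => i.elim0⟩⟩, fun v => Subsingleton.elim _ _⟩
    simp
  | succ k ih =>
    have := Fintype.ofFinite (IsotropicFrame σ k)
    rw [Nat.card_congr (isotropicFrameSuccEquiv hσ k), Nat.card_sigma, Finset.prod_range_succ, ← ih]
    rw [Finset.sum_const_nat (m := Fintype.card F ^ (Module.finrank F V - k) - Fintype.card F ^ k),
      Finset.card_univ, Nat.card_eq_fintype_card]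
    rintro ⟨v, hl, hv⟩ -
    have hle : Submodule.span F (Set.range v) ≤
        σ.orthogonal (Submodule.span F (Set.range v)) := by
      rw [Submodule.span_le]
      rintro _ ⟨j, rfl⟩
      exact mem_orthogonal_span_range.2 fun i => hv i j
    have hc (W : Submodule F V) : (W : Set V).ncard = Fintype.card F ^ Module.finrank F W := by
      rw [← Nat.card_coe_set_eq, ← Nat.card_eq_fintype_card (α := F)]
      exact Module.natCard_eq_pow_finrank (K := F) (V := W)
    rw [Nat.card_coe_set_eq, Set.ncard_sdiff hle, hc, hc, LinearMap.BilinForm.finrank_orthogonal hn,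
      finrank_span_eq_card hl, Fintype.card_fin]

theorem card_isotropicFrame_eq_mul (σ : LinearMap.BilinForm F V) (k : ℕ) :
    Nat.card (IsotropicFrame σ k) = (symplecticGrassmannian σ k).ncard *
      ∏ i ∈ Finset.range k, (Fintype.card F ^ k - Fintype.card F ^ i) := by
  have : Finite V := Module.finite_of_finite F
  have : Finite (Grassmannian F V k) := inferInstance
  have := Fintype.ofFinite (symplecticGrassmannian σ k)
  rw [Nat.card_congr (isotropicFrameEquiv σ k), Nat.card_sigma,
    Finset.sum_const_nat (m := ∏ i ∈ Finset.range k, (Fintype.card F ^ k - Fintype.card F ^ i)),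
    Finset.card_univ, ← Nat.card_eq_fintype_card, Nat.card_coe_set_eq]
  rintro ⟨⟨W, hk⟩, hW⟩ -
  have := card_linearIndependent (K := F) (V := W) (k := k) hk.ge
  rw [hk] at this
  rw [this, Finset.prod_range]

theorem ncard_symplecticGrassmannian {σ : LinearMap.BilinForm F V} (hσ : σ.IsAlt)
    (hn : σ.Nondegenerate) {n k : ℕ} (hV : Module.finrank F V = 2 * n) (hk : k ≤ n) :
    ((symplecticGrassmannian σ k).ncard : ℚ) = ∏ i ∈ Finset.range k,
      ((Fintype.card F : ℚ) ^ (2 * n - 2 * i) - 1) / ((Fintype.card F : ℚ) ^ (i + 1) - 1) := by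
  have hq : 1 < Fintype.card F := Fintype.one_lt_card
  have hq' : (1 : ℚ) < Fintype.card F := by exact_mod_cast hq
  set q := Fintype.card F
  have h := (card_isotropicFrame_eq_mul σ k).symm.trans (card_isotropicFrame hσ hn k)
  rw [hV] at h
  have h1 : ((∏ i ∈ Finset.range k, (q ^ (2 * n - i) - q ^ i) : ℕ) : ℚ) =
      (∏ i ∈ Finset.range k, (q : ℚ) ^ i) *
        ∏ i ∈ Finset.range k, ((q : ℚ) ^ (2 * n - 2 * i) - 1) := by
    rw [← Finset.prod_mul_distrib, Nat.cast_prod]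
    refine Finset.prod_congr rfl fun i hi => ?_
    have hi := Finset.mem_range.1 hi
    rw [Nat.cast_sub (Nat.pow_le_pow_right hq.le (by omega)), mul_sub, ← pow_add]
    push_cast
    rw [show i + (2 * n - 2 * i) = 2 * n - i by omega, mul_one]
  have h2 : ((∏ i ∈ Finset.range k, (q ^ k - q ^ i) : ℕ) : ℚ) =
      (∏ i ∈ Finset.range k, (q : ℚ) ^ i) *
        ∏ i ∈ Finset.range k, ((q : ℚ) ^ (i + 1) - 1) := by
    -- Since `q^k - q^i = q^i (q^(k-i) - 1)`, the factors appear in reverse order.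
    rw [← Finset.prod_range_reflect (fun i => (q : ℚ) ^ (i + 1) - 1),
      ← Finset.prod_mul_distrib, Nat.cast_prod]
    refine Finset.prod_congr rfl fun i hi => ?_
    have hi := Finset.mem_range.1 hi
    rw [Nat.cast_sub (Nat.pow_le_pow_right hq.le (by omega)), mul_sub, ← pow_add]
    push_cast
    rw [show i + (k - 1 - i + 1) = k by omega, mul_one]
  have h3 : ∏ i ∈ Finset.range k, (q : ℚ) ^ i ≠ 0 :=
    Finset.prod_ne_zero_iff.2 fun i _ => pow_ne_zero _ (by positivity)
  have h4 : ∏ i ∈ Finset.range k, ((q : ℚ) ^ (i + 1) - 1) ≠ 0 :=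
    Finset.prod_ne_zero_iff.2 fun i _ => (sub_pos.2 (one_lt_pow₀ hq' (by omega))).ne'
  rw [Finset.prod_div_distrib, eq_div_iff h4]
  have h5 := congrArg (Nat.cast : ℕ → ℚ) h
  rw [Nat.cast_mul, h1, h2] at h5
  apply mul_left_cancel₀ h3
  rw [← h5]
  ring

end Counting

/-- The binomial coefficient `N` over `k - 2`, equal to `0` for `k < 2`. -/
def chooseSubTwo (N : ℕ) : ℕ → ℕ
  | 0 => 0
  | 1 => 0
  | k + 2 => N.choose k

theorem binom_sub_two (N k : ℕ) : binom N ((k : ℤ) - 2) = chooseSubTwo N k := by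
  match k with
  | 0 => rfl
  | 1 => rfl
  | k + 2 => simp [binom, chooseSubTwo]

/-! ### Splitting off a hyperbolic pair. -/

section HyperbolicPairs

variable {F V : Type*} [Field F] [AddCommGroup V] [Module F V]

/-- The vectors of `U` orthogonal to `e` and `f`. -/
def perpPair (σ : LinearMap.BilinForm F V) (U : Submodule F V) (e f : V) : Submodule F V :=
  U ⊓ LinearMap.ker (σ e) ⊓ LinearMap.ker (σ f)

theorem mem_perpPair {σ : LinearMap.BilinForm F V} {U : Submodule F V} {e f x : V} :
    x ∈ perpPair σ U e f ↔ x ∈ U ∧ σ e x = 0 ∧ σ f x = 0 := by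
  simp [perpPair, and_assoc]

/-- The form `σ` has no radical on `U`. -/
def NondegenerateOn (σ : LinearMap.BilinForm F V) (U : Submodule F V) : Prop :=
  ∀ x ∈ U, (∀ y ∈ U, σ x y = 0) → x = 0

theorem NondegenerateOn.exists_pair {σ : LinearMap.BilinForm F V} {U : Submodule F V}
    (hU : NondegenerateOn σ U) (h0 : U ≠ ⊥) : ∃ e ∈ U, ∃ f ∈ U, σ e f = 1 := by
  obtain ⟨e, he, he0⟩ := Submodule.exists_mem_ne_zero_of_ne_bot h0
  have : ∃ y ∈ U, σ e y ≠ 0 := by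
    by_contra! h
    exact he0 (hU e he h)
  obtain ⟨y, hy, h⟩ := this
  exact ⟨e, he, (σ e y)⁻¹ • y, U.smul_mem _ hy, by simp [h]⟩

variable {σ : LinearMap.BilinForm F V} (hσ : σ.IsAlt) {U : Submodule F V} {e f : V}
include hσ

/-- This is the projection along the hyperbolic plane `⟨e, f⟩`. -/
theorem sub_mem_perpPair (he : e ∈ U) (hf : f ∈ U) (hef : σ e f = 1) {y : V} (hy : y ∈ U) :
    y - (σ e y • f - σ f y • e) ∈ perpPair σ U e f := by
  have hfe : σ f e = -1 := by rw [← hσ.neg_eq, hef]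
  refine mem_perpPair.2 ⟨?_, ?_, ?_⟩
  · exact U.sub_mem hy (U.sub_mem (U.smul_mem _ hf) (U.smul_mem _ he))
  · simp [hσ.self_eq_zero, hef]
  · simp [hσ.self_eq_zero, hfe]

theorem NondegenerateOn.perpPair (hU : NondegenerateOn σ U) (he : e ∈ U) (hf : f ∈ U)
    (hef : σ e f = 1) : NondegenerateOn σ (perpPair σ U e f) := by
  intro x hx h
  obtain ⟨hxU, hex, hfx⟩ := mem_perpPair.1 hx
  refine hU x hxU fun y hy => ?_
  have := h _ (sub_mem_perpPair hσ he hf hef hy)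
  simpa [hσ.isRefl _ _ hex, hσ.isRefl _ _ hfx] using this

theorem finrank_perpPair [FiniteDimensional F V] (he : e ∈ U) (hf : f ∈ U) (hef : σ e f = 1) :
    Module.finrank F (perpPair σ U e f) + 2 = Module.finrank F U := by
  have hfe : σ f e = -1 := by rw [← hσ.neg_eq, hef]
  let T : U →ₗ[F] F × F := ((σ e).prod (σ f)).domRestrict U
  have hT : LinearMap.range T = ⊤ := by
    rw [LinearMap.range_eq_top]
    rintro ⟨a, b⟩
    refine ⟨⟨a • f - b • e, U.sub_mem (U.smul_mem _ hf) (U.smul_mem _ he)⟩, ?_⟩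
    simp [T, hσ.self_eq_zero, hef, hfe]
  have hk : (LinearMap.ker T).map U.subtype = SymplecticGrassmann.perpPair σ U e f := by
    ext x
    simp only [Submodule.mem_map, mem_perpPair]
    constructor
    · rintro ⟨y, hy, rfl⟩
      have : σ e y = 0 ∧ σ f y = 0 := by simpa [T] using hy
      exact ⟨y.2, this⟩
    · rintro ⟨h1, h2, h3⟩
      exact ⟨⟨x, h1⟩, by simp [T, h2, h3], rfl⟩
  have := LinearMap.finrank_range_add_finrank_ker T
  rw [hT, finrank_top, Module.finrank_prod, Module.finrank_self] at this
  rw [← hk, ← (Submodule.equivMapOfInjective _ U.injective_subtype _).finrank_eq]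
  omega

end HyperbolicPairs

/-! ### Dimension bounds for isotropic subspaces. -/

section IsotropicDimension

variable {F V : Type*} [Field F] [AddCommGroup V] [Module F V] [FiniteDimensional F V]
  {σ : LinearMap.BilinForm F V} (hσ : σ.IsAlt) (hn : σ.Nondegenerate)
include hσ hn

theorem two_mul_finrank_le_of_isotropic {U T : Submodule F V} (hU : NondegenerateOn σ U)
    (hTU : T ≤ U) (hT : ∀ x ∈ T, ∀ y ∈ T, σ x y = 0) :
    2 * Module.finrank F T ≤ Module.finrank F U := by
  have hdis : Disjoint T (σ.orthogonal U) := by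
    rw [Submodule.disjoint_def]
    intro x hx hx'
    exact hU x (hTU hx) fun y hy => hσ.isRefl _ _ (hx' y hy)
  have hle : T ≤ σ.orthogonal (T ⊔ σ.orthogonal U) := by
    intro x hx y hy
    obtain ⟨a, ha, b, hb, rfl⟩ := Submodule.mem_sup.1 hy
    have h1 : σ b x = 0 := hσ.isRefl _ _ (hb x (hTU hx))
    simp [hT a ha x hx, h1]
  have h1 := Submodule.finrank_mono hle
  have h2 := Submodule.finrank_sup_add_finrank_inf_eq T (σ.orthogonal U)
  rw [hdis.eq_bot, finrank_bot] at h2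
  rw [LinearMap.BilinForm.finrank_orthogonal hn] at h1 h2
  have h3 := Submodule.finrank_le U
  have h4 := Submodule.finrank_le (T ⊔ σ.orthogonal U)
  omega

/-- The vectors of `U` orthogonal to all `v i` form a space of dimension at least `2m - k > m`, too
large to be totally isotropic. -/
theorem exists_pair_orthogonal {U : Submodule F V} (hU : NondegenerateOn σ U) {k m : ℕ}
    (hm : Module.finrank F U = 2 * m) (hk : k < m) (v : Fin k → V) :
    ∃ u ∈ U, ∃ w ∈ U, σ u w = 1 ∧ (∀ i, σ (v i) u = 0) ∧ ∀ i, σ (v i) w = 0 := by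
  set W := Submodule.span F (Set.range v)
  have hW : Module.finrank F W ≤ k := (finrank_range_le_card (R := F) v).trans (by simp)
  have h1 := Submodule.finrank_sup_add_finrank_inf_eq U (σ.orthogonal W)
  rw [LinearMap.BilinForm.finrank_orthogonal hn] at h1
  have h2 := Submodule.finrank_le (U ⊔ σ.orthogonal W)
  have h3 := Submodule.finrank_le W
  have : ∃ u ∈ U ⊓ σ.orthogonal W, ∃ w ∈ U ⊓ σ.orthogonal W, σ u w ≠ 0 := by
    by_contra! h
    have := two_mul_finrank_le_of_isotropic hσ hn hU inf_le_left h
    omega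
  obtain ⟨u, hu, w, hw, h⟩ := this
  exact ⟨u, hu.1, (σ u w)⁻¹ • w, U.smul_mem _ hw.1, by simp [h],
    mem_orthogonal_span_range.1 hu.2,
    mem_orthogonal_span_range.1 ((σ.orthogonal W).smul_mem _ hw.2)⟩

end IsotropicDimension

/-! ### Lower bound for the dimension, by contractions and Pascal's rule. -/

section LowerBound

theorem finrank_add_finrank_le_of_le_ker {F A : Type*} [Field F] [AddCommGroup A] [Module F A]
    {L P Q : Submodule F A} [FiniteDimensional F L] (T : A →ₗ[F] A) (hPL : P ≤ L)
    (hP : P ≤ LinearMap.ker T) (hQ : Q ≤ L.map T) :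
    Module.finrank F P + Module.finrank F Q ≤ Module.finrank F L := by
  have h1 := LinearMap.finrank_range_add_finrank_ker (T.domRestrict L)
  have h2 : LinearMap.range (T.domRestrict L) = L.map T := LinearMap.range_domRestrict L T
  rw [h2] at h1
  have h3 := Submodule.finrank_mono hQ
  have h4 : P ≤ (LinearMap.ker (T.domRestrict L)).map L.subtype := by
    intro x hx
    exact ⟨⟨x, hPL hx⟩, by simpa using hP hx, rfl⟩
  have h5 := Submodule.finrank_mono h4
  rw [← (Submodule.equivMapOfInjective _ L.injective_subtype _).finrank_eq] at h5
  omega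

variable {F V : Type*} [Field F] [AddCommGroup V] [Module F V]

open ExteriorAlgebra

/-- Contraction in the exterior algebra with the linear form `σ x`. -/
abbrev contract {R M : Type*} [CommRing R] [AddCommGroup M] [Module R M]
    (τ : LinearMap.BilinForm R M) (x : M) : ExteriorAlgebra R M →ₗ[R] ExteriorAlgebra R M :=
  CliffordAlgebra.contractLeft (Q := (0 : QuadraticForm R M)) (τ x)

theorem contract_ι_mul {R M : Type*} [CommRing R] [AddCommGroup M] [Module R M]
    (τ : LinearMap.BilinForm R M) (x v : M) (y : ExteriorAlgebra R M) :
    contract τ x (ι R v * y) = τ x v • y - ι R v * contract τ x y :=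
  CliffordAlgebra.contractLeft_ι_mul _ _ _

theorem contract_ιMulti_eq_zero {R M : Type*} [CommRing R] [AddCommGroup M] [Module R M]
    (τ : LinearMap.BilinForm R M) (x : M) {k : ℕ} (v : Fin k → M) (h : ∀ i, τ x (v i) = 0) :
    contract τ x (ιMulti R k v) = 0 := by
  induction k with
  | zero =>
    rw [ιMulti_zero_apply]
    exact CliffordAlgebra.contractLeft_one (Q := (0 : QuadraticForm R M)) (τ x)
  | succ k ih =>
    rw [ιMulti_succ_apply, contract_ι_mul, h, ih (Matrix.vecTail v) (fun i => h _), zero_smul, mul_zero, sub_zero]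

theorem ι_mul_ιMulti {R M : Type*} [CommRing R] [AddCommGroup M] [Module R M] (x : M) {k : ℕ}
    (v : Fin k → M) : ι R x * ιMulti R k v = ιMulti R (k + 1) (Fin.cons x v) := by
  rw [ιMulti_succ_apply]
  simp [Matrix.vecTail, Function.comp_def]

theorem isotropicSpan_mono (σ : LinearMap.BilinForm F V) {U U' : Submodule F V} (h : U ≤ U')
    (k : ℕ) : isotropicSpan σ U k ≤ isotropicSpan σ U' k := by
  apply Submodule.span_mono
  rintro _ ⟨v, h1, h2, rfl⟩
  exact ⟨v, fun i => h (h1 i), h2, rfl⟩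

theorem ι_mul_mem_isotropicSpan {σ : LinearMap.BilinForm F V} (hσ : σ.IsAlt) {U : Submodule F V}
    {k : ℕ} {x : V} (hx : x ∈ U) {v : Fin k → V} (hv : ∀ i, v i ∈ U)
    (hv' : ∀ i j, σ (v i) (v j) = 0) (hxv : ∀ i, σ x (v i) = 0) :
    ι F x * ιMulti F k v ∈ isotropicSpan σ U (k + 1) := by
  rw [ι_mul_ιMulti]
  refine Submodule.subset_span ⟨Fin.cons x v, fun i => ?_, fun i j => ?_, rfl⟩
  · cases i using Fin.cases <;> simp [hx, hv]
  · cases i using Fin.cases with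
    | zero =>
      cases j using Fin.cases with
      | zero => simpa using hσ _
      | succ j => simpa using hxv j
    | succ i =>
      cases j using Fin.cases with
      | zero => simpa using hσ.isRefl _ _ (hxv i)
      | succ j => simpa using hv' i j

theorem ι_mul_ι_mul_mem_isotropicSpan {σ : LinearMap.BilinForm F V} (hσ : σ.IsAlt)
    {U : Submodule F V} {k : ℕ} {x y : V} (hx : x ∈ U) (hy : y ∈ U) (hxy : σ x y = 0)
    {v : Fin k → V} (hv : ∀ i, v i ∈ U)
    (hv' : ∀ i j, σ (v i) (v j) = 0) (hxv : ∀ i, σ x (v i) = 0) (hyv : ∀ i, σ y (v i) = 0) :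
    ι F x * (ι F y * ιMulti F k v) ∈ isotropicSpan σ U (k + 2) := by
  rw [ι_mul_ιMulti]
  refine ι_mul_mem_isotropicSpan hσ hx (fun i => ?_) (fun i j => ?_) (fun i => ?_)
  · cases i using Fin.cases <;> simp [hy, hv]
  · cases i using Fin.cases with
    | zero =>
      cases j using Fin.cases with
      | zero => simpa using hσ _
      | succ j => simpa using hyv j
    | succ i =>
      cases j using Fin.cases with
      | zero => simpa using hσ.isRefl _ _ (hyv i)
      | succ j => simpa using hv' i j
  · cases i using Fin.cases <;> simp [hxy, hxv]

instance [FiniteDimensional F V] (σ : LinearMap.BilinForm F V) (U : Submodule F V) (k : ℕ) :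
    FiniteDimensional F (isotropicSpan σ U k) :=
  Submodule.finiteDimensional_of_le (isotropicSpan_le_exteriorPower σ U k)

theorem contract_eq_zero_of_mem_isotropicSpan {σ : LinearMap.BilinForm F V} {U : Submodule F V}
    {k : ℕ} {x : V} (hx : ∀ u ∈ U, σ x u = 0) :
    isotropicSpan σ U k ≤ LinearMap.ker (contract σ x) := by
  refine Submodule.span_le.2 ?_
  rintro _ ⟨v, hv, -, rfl⟩
  exact contract_ιMulti_eq_zero σ x v fun i => hx _ (hv i)

variable {σ : LinearMap.BilinForm F V} (hσ : σ.IsAlt)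
include hσ

/-- Write `L'ⱼ` for the isotropic span of `U'` in degree `j`. In the chain `L'ₖ₊₁ ≤ L'ₖ₊₁ + f ∧ L'ₖ
≤ L'ₖ₊₁ + f ∧ L'ₖ + e ∧ L'ₖ ≤ L`, each term is killed by an operator (contraction with `e`, with
`f`, with both) mapping the next term onto a space containing `L'ₖ`, `L'ₖ`, `Q` respectively. `Q` is
left free because degree one has no span two degrees lower. -/
theorem finrank_isotropicSpan_succ [FiniteDimensional F V] {U : Submodule F V} {e f : V}
    (he : e ∈ U) (hf : f ∈ U) (hef : σ e f = 1) (k : ℕ) (Q : Submodule F (ExteriorAlgebra F V))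
    (hQ : Q ≤ (isotropicSpan σ U (k + 1)).map (contract σ f ∘ₗ contract σ e)) :
    Module.finrank F (isotropicSpan σ (perpPair σ U e f) (k + 1)) +
      2 * Module.finrank F (isotropicSpan σ (perpPair σ U e f) k) + Module.finrank F Q ≤
      Module.finrank F (isotropicSpan σ U (k + 1)) := by
  have hfe : σ f e = -1 := by rw [← hσ.neg_eq, hef]
  set U' := perpPair σ U e f with hU'
  have hUU : U' ≤ U := fun x hx => (mem_perpPair.1 hx).1
  have hkere (j) : isotropicSpan σ U' j ≤ LinearMap.ker (contract σ e) :=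
    contract_eq_zero_of_mem_isotropicSpan fun u hu => (mem_perpPair.1 hu).2.1
  have hkerf (j) : isotropicSpan σ U' j ≤ LinearMap.ker (contract σ f) :=
    contract_eq_zero_of_mem_isotropicSpan fun u hu => (mem_perpPair.1 hu).2.2
  let E := (isotropicSpan σ U' k).map (LinearMap.mulLeft F (ι F e))
  let G := (isotropicSpan σ U' k).map (LinearMap.mulLeft F (ι F f))
  have hEL : E ≤ isotropicSpan σ U (k + 1) := by
    refine Submodule.map_le_iff_le_comap.2 (Submodule.span_le.2 ?_)
    rintro _ ⟨v, h1, h2, rfl⟩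
    exact ι_mul_mem_isotropicSpan hσ he (fun i => hUU (h1 i)) h2
      fun i => (mem_perpPair.1 (h1 i)).2.1
  have hGL : G ≤ isotropicSpan σ U (k + 1) := by
    refine Submodule.map_le_iff_le_comap.2 (Submodule.span_le.2 ?_)
    rintro _ ⟨v, h1, h2, rfl⟩
    exact ι_mul_mem_isotropicSpan hσ hf (fun i => hUU (h1 i)) h2
      fun i => (mem_perpPair.1 (h1 i)).2.2
  have hLL := isotropicSpan_mono σ hUU (k + 1)
  let L1 := isotropicSpan σ U' (k + 1) ⊔ G
  let L2 := L1 ⊔ E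
  have hL1 : L1 ≤ isotropicSpan σ U (k + 1) := sup_le hLL hGL
  have hL2 : L2 ≤ isotropicSpan σ U (k + 1) := sup_le hL1 hEL
  have : FiniteDimensional F L1 := Submodule.finiteDimensional_of_le hL1
  have : FiniteDimensional F L2 := Submodule.finiteDimensional_of_le hL2
  have s1 := finrank_add_finrank_le_of_le_ker (L := L1) (Q := isotropicSpan σ U' k)
    (contract σ e) le_sup_left (hkere _) (by
      intro x hx
      refine ⟨ι F f * x, Submodule.mem_sup_right ⟨x, hx, rfl⟩, ?_⟩
      rw [contract_ι_mul, hef, LinearMap.mem_ker.1 (hkere _ hx)]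
      simp)
  have hGf : G ≤ LinearMap.ker (contract σ f) := by
    rintro _ ⟨x, hx, rfl⟩
    simp [contract_ι_mul, LinearMap.mem_ker.1 (hkerf _ hx), hσ.self_eq_zero]
  have hEe : E ≤ LinearMap.ker (contract σ e) := by
    rintro _ ⟨x, hx, rfl⟩
    simp [contract_ι_mul, LinearMap.mem_ker.1 (hkere _ hx), hσ.self_eq_zero]
  have s2 := finrank_add_finrank_le_of_le_ker (L := L2) (Q := isotropicSpan σ U' k)
    (contract σ f) le_sup_left (sup_le (hkerf _) hGf) (by
      intro x hx
      refine ⟨-(ι F e * x), Submodule.mem_sup_right (E.neg_mem ⟨x, hx, rfl⟩), ?_⟩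
      rw [map_neg, contract_ι_mul, hfe, LinearMap.mem_ker.1 (hkerf _ hx)]
      simp)
  have s3 := finrank_add_finrank_le_of_le_ker (L := isotropicSpan σ U (k + 1))
    (contract σ f ∘ₗ contract σ e) hL2 (by
      refine sup_le (sup_le ?_ ?_) ?_
      · intro x hx
        simp [LinearMap.mem_ker.1 (hkere _ hx)]
      · rintro _ ⟨x, hx, rfl⟩
        simp [contract_ι_mul, LinearMap.mem_ker.1 (hkerf _ hx),
          LinearMap.mem_ker.1 (hkere _ hx)]
      · intro x hx
        simp [LinearMap.mem_ker.1 (hEe hx)]) hQ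
  omega

/-- The product `e ∧ f ∧ v` is not isotropic, but `(e ∧ f - u ∧ w) ∧ v` is a combination of
isotropic products when `u, w` is a hyperbolic pair of `U'` orthogonal to `v`, and it contracts to
`v`. Such a pair exists because `k < m`. -/
theorem isotropicSpan_le_map_contract [FiniteDimensional F V] (hn : σ.Nondegenerate)
    {U : Submodule F V} (hU : NondegenerateOn σ U) {e f : V}
    (he : e ∈ U) (hf : f ∈ U) (hef : σ e f = 1) {k m : ℕ}
    (hm : Module.finrank F U = 2 * (m + 1)) (hk : k < m) :
    isotropicSpan σ (perpPair σ U e f) k ≤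
      (isotropicSpan σ U (k + 2)).map (contract σ f ∘ₗ contract σ e) := by
  have hfe : σ f e = -1 := by rw [← hσ.neg_eq, hef]
  refine Submodule.span_le.2 ?_
  rintro _ ⟨v, h1, h2, rfl⟩
  have hm' := finrank_perpPair hσ he hf hef
  obtain ⟨u, hu, w, hw, huw, hvu, hvw⟩ := exists_pair_orthogonal hσ hn
    (hU.perpPair hσ he hf hef) (m := m) (by omega) hk v
  obtain ⟨huU, heu, hfu⟩ := mem_perpPair.1 hu
  obtain ⟨hwU, hew, hfw⟩ := mem_perpPair.1 hw
  have hv (i) := mem_perpPair.1 (h1 i)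
  have huv (i) := hσ.isRefl _ _ (hvu i)
  have hwv (i) := hσ.isRefl _ _ (hvw i)
  have m1 := ι_mul_ι_mul_mem_isotropicSpan hσ (U := U) (x := e + u) (y := f - w)
    (U.add_mem he huU) (U.sub_mem hf hwU)
    (by simp [hef, hew, hσ.isRefl _ _ hfu, huw]) (fun i => (hv i).1) h2
    (fun i => by simp [(hv i).2.1, huv i]) (fun i => by simp [(hv i).2.2, hwv i])
  have m2 := ι_mul_ι_mul_mem_isotropicSpan hσ (U := U) he hwU hew (fun i => (hv i).1) h2
    (fun i => (hv i).2.1) hwv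
  have m3 := ι_mul_ι_mul_mem_isotropicSpan hσ (U := U) huU hf (hσ.isRefl _ _ hfu)
    (fun i => (hv i).1) h2 huv (fun i => (hv i).2.2)
  -- `(e + u) ∧ (f - w) + e ∧ w - u ∧ f = e ∧ f - u ∧ w`.
  refine ⟨_, add_mem m1 (sub_mem m2 m3), ?_⟩
  have ce := contract_ιMulti_eq_zero σ e v fun i => (hv i).2.1
  have cf := contract_ιMulti_eq_zero σ f v fun i => (hv i).2.2
  simp [add_mul, sub_mul, mul_sub, contract_ι_mul, ce, cf, hef, hfe, heu, hew,
    hσ.self_eq_zero]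

/-- The range reaches `m + 1`, one beyond the meaningful degrees, because degree `k` for `U` calls
on degree `k` for the smaller `U'`. -/
theorem choose_le_finrank_isotropicSpan [FiniteDimensional F V] (hn : σ.Nondegenerate) (m : ℕ)
    (U : Submodule F V) (hU : NondegenerateOn σ U) (hm : Module.finrank F U = 2 * m) (k : ℕ)
    (hk : k ≤ m + 1) :
    (2 * m).choose k ≤ Module.finrank F (isotropicSpan σ U k) + chooseSubTwo (2 * m) k := by
  have hone (U : Submodule F V) : 1 ≤ Module.finrank F (isotropicSpan σ U 0) := by
    rw [Nat.one_le_iff_ne_zero, Ne, Submodule.finrank_eq_zero, ← Ne, Submodule.ne_bot_iff]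
    exact ⟨1, Submodule.subset_span ⟨Fin.elim0, fun i => i.elim0, fun i => i.elim0, by simp⟩,
      one_ne_zero⟩
  induction m generalizing U k with
  | zero =>
    match k with
    | 0 => simpa [chooseSubTwo] using hone U
    | 1 => simp
  | succ m ih =>
    have h0 : U ≠ ⊥ := by
      rintro rfl
      simp at hm
    obtain ⟨e, he, f, hf, hef⟩ := hU.exists_pair h0
    have hm' := finrank_perpPair hσ he hf hef
    replace ih := ih (perpPair σ U e f) (hU.perpPair hσ he hf hef) (by omega)
    rw [show 2 * (m + 1) = 2 * m + 2 by ring]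
    match k with
    | 0 => simpa [chooseSubTwo] using hone U
    | 1 =>
      have h1 := ih 1 (by omega)
      have h2 := ih 0 (by omega)
      have h3 : Module.finrank F (isotropicSpan σ (perpPair σ U e f) 1) +
          2 * Module.finrank F (isotropicSpan σ (perpPair σ U e f) 0) +
          Module.finrank F (⊥ : Submodule F (ExteriorAlgebra F V)) ≤
          Module.finrank F (isotropicSpan σ U 1) :=
        finrank_isotropicSpan_succ hσ he hf hef 0 ⊥ bot_le
      simp only [chooseSubTwo, Nat.choose_zero_right, Nat.choose_one_right, add_zero,
        finrank_bot] at h1 h2 h3 ⊢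
      omega
    | k + 2 =>
      by_cases hkm : k + 2 = m + 1 + 1
      -- In the extra degree the two binomials agree by symmetry, so the bound is vacuous.
      · have : (2 * m + 2).choose (k + 2) = (2 * m + 2).choose k :=
          Nat.choose_symm_of_eq_add (by omega)
        simp [chooseSubTwo, this]
      have h2 := ih (k + 2) (by omega)
      have h1 := ih (k + 1) (by omega)
      have h0 := ih k (by omega)
      have h3 : Module.finrank F (isotropicSpan σ (perpPair σ U e f) (k + 2)) +
          2 * Module.finrank F (isotropicSpan σ (perpPair σ U e f) (k + 1)) +
          Module.finrank F (isotropicSpan σ (perpPair σ U e f) k) ≤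
          Module.finrank F (isotropicSpan σ U (k + 2)) :=
        finrank_isotropicSpan_succ hσ he hf hef (k + 1) _
          (isotropicSpan_le_map_contract hσ hn hU he hf hef (k := k) hm (by omega))
      have c1 : (2 * m + 2).choose (k + 2) = (2 * m).choose (k + 2) +
          2 * (2 * m).choose (k + 1) + (2 * m).choose k := by
        simp only [Nat.choose_succ_succ']
        ring
      have c2 : chooseSubTwo (2 * m + 2) (k + 2) = chooseSubTwo (2 * m) (k + 2) +
          2 * chooseSubTwo (2 * m) (k + 1) + chooseSubTwo (2 * m) k := by
        match k with
        | 0 => simp [chooseSubTwo]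
        | 1 => simp [chooseSubTwo]
        | k + 2 =>
          simp only [chooseSubTwo, Nat.choose_succ_succ']
          ring
      rw [c1, c2]
      omega

end LowerBound

open ExteriorAlgebra

/-- `e₁, …, eₙ, f₁, …, fₙ` is a symplectic basis for the form `τ`. -/
structure IsSymplecticBasis {R M : Type*} [CommRing R] [AddCommGroup M] [Module R M]
    (τ : LinearMap.BilinForm R M) {n : ℕ} (e f : Fin n → M) : Prop where
  apply_left_left : ∀ i j, τ (e i) (e j) = 0
  apply_right_right : ∀ i j, τ (f i) (f j) = 0
  apply_left_right : ∀ i j, τ (e i) (f j) = if i = j then 1 else 0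
  sum_eq : ∀ v, ∑ i, (τ v (f i) • e i - τ v (e i) • f i) = v

/-! ### Existence of symplectic bases. -/

section Existence

theorem nondegenerateOn_top {F V : Type*} [Field F] [AddCommGroup V] [Module F V]
    {σ : LinearMap.BilinForm F V} (hn : σ.Nondegenerate) : NondegenerateOn σ ⊤ :=
  fun x _ h => hn.1 x fun y => h y Submodule.mem_top

variable {F V : Type*} [Field F] [AddCommGroup V] [Module F V] [FiniteDimensional F V]
  {σ : LinearMap.BilinForm F V}

theorem exists_symplecticBasis_on (hσ : σ.IsAlt) (n : ℕ) (U : Submodule F V)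
    (hU : NondegenerateOn σ U) (hn : Module.finrank F U = 2 * n) :
    ∃ e f : Fin n → V, (∀ i, e i ∈ U) ∧ (∀ i, f i ∈ U) ∧ (∀ i j, σ (e i) (e j) = 0) ∧
      (∀ i j, σ (f i) (f j) = 0) ∧ (∀ i j, σ (e i) (f j) = if i = j then 1 else 0) ∧
      ∀ v ∈ U, ∑ i, (σ v (f i) • e i - σ v (e i) • f i) = v := by
  induction n generalizing U with
  | zero =>
    refine ⟨Fin.elim0, Fin.elim0, fun i => i.elim0, fun i => i.elim0, fun i => i.elim0,
      fun i => i.elim0, fun i => i.elim0, fun v hv => ?_⟩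
    rw [mul_zero, Submodule.finrank_eq_zero] at hn
    subst hn
    simpa using hv.symm
  | succ n ih =>
    have h0 : U ≠ ⊥ := by
      rintro rfl
      simp at hn
    obtain ⟨x, hx, y, hy, hxy⟩ := hU.exists_pair h0
    have hyx : σ y x = -1 := by rw [← hσ.neg_eq, hxy]
    have hn' := finrank_perpPair hσ hx hy hxy
    obtain ⟨e, f, he, hf, hee, hff, hef, hs⟩ :=
      ih (perpPair σ U x y) (hU.perpPair hσ hx hy hxy) (by omega)
    have he' (i) := mem_perpPair.1 (he i)
    have hf' (i) := mem_perpPair.1 (hf i)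
    have hex (i) := hσ.isRefl _ _ (he' i).2.1
    have hey (i) := hσ.isRefl _ _ (he' i).2.2
    have hfx (i) := hσ.isRefl _ _ (hf' i).2.1
    have hfy (i) := hσ.isRefl _ _ (hf' i).2.2
    refine ⟨Fin.cons x e, Fin.cons y f, ?_, ?_, ?_, ?_, ?_, ?_⟩
    · intro i
      cases i using Fin.cases <;> simp [hx, (he' _).1]
    · intro i
      cases i using Fin.cases <;> simp [hy, (hf' _).1]
    · intro i j
      cases i using Fin.cases <;> cases j using Fin.cases <;>
        simp [hσ.self_eq_zero, hee, hex, (he' _).2.1]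
    · intro i j
      cases i using Fin.cases <;> cases j using Fin.cases <;>
        simp [hσ.self_eq_zero, hff, hfy, (hf' _).2.2]
    · intro i j
      cases i using Fin.cases <;> cases j using Fin.cases <;>
        simp [hxy, hef, hey, (hf' _).2.1, Fin.succ_ne_zero, (Fin.succ_ne_zero _).symm]
    · intro v hv
      have h := hs _ (sub_mem_perpPair hσ hx hy hxy hv)
      simp only [map_sub, map_smul, LinearMap.sub_apply, LinearMap.smul_apply, (he' _).2.1,
        (he' _).2.2, (hf' _).2.1, (hf' _).2.2, smul_zero, sub_zero] at h
      rw [Fin.sum_univ_succ]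
      simp only [Fin.cons_zero, Fin.cons_succ]
      rw [h, ← hσ.neg_eq v y, ← hσ.neg_eq v x]
      module

theorem exists_isSymplecticBasis (hσ : σ.IsAlt) (hn : σ.Nondegenerate) {n : ℕ}
    (hV : Module.finrank F V = 2 * n) : ∃ e f : Fin n → V, IsSymplecticBasis σ e f := by
  obtain ⟨e, f, -, -, h1, h2, h3, h4⟩ := exists_symplecticBasis_on hσ n ⊤
    (nondegenerateOn_top hn) (by rw [finrank_top, hV])
  exact ⟨e, f, h1, h2, h3, fun v => h4 v Submodule.mem_top⟩

end Existence

/-! ### Contraction and the grading, over a commutative ring. -/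

section Degrees

variable {R M : Type*} [CommRing R] [AddCommGroup M] [Module R M]

theorem ι_mul_mem_exteriorPower (x : M) {k : ℕ} {y : ExteriorAlgebra R M} (hy : y ∈ ⋀[R]^k M) :
    ι R x * y ∈ ⋀[R]^(k + 1) M := by
  rw [exteriorPower, pow_succ']
  exact Submodule.mul_mem_mul ⟨x, rfl⟩ hy

theorem exteriorPower_le {k : ℕ} {S : Submodule R (ExteriorAlgebra R M)}
    (h : ∀ v : Fin k → M, ιMulti R k v ∈ S) : ⋀[R]^k M ≤ S := by
  rw [← ExteriorAlgebra.ιMulti_span_fixedDegree, Submodule.span_le]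
  rintro _ ⟨v, rfl⟩
  exact h v

theorem ιMulti_mem_exteriorPower {k : ℕ} (v : Fin k → M) : ιMulti R k v ∈ ⋀[R]^k M := by
  rw [← ExteriorAlgebra.ιMulti_span_fixedDegree]
  exact Submodule.subset_span ⟨v, rfl⟩

variable (τ : LinearMap.BilinForm R M)

theorem contract_one (x : M) : contract τ x 1 = 0 :=
  CliffordAlgebra.contractLeft_one (Q := (0 : QuadraticForm R M)) (τ x)

theorem contract_eq_zero_of_mem_zero (x : M) : ⋀[R]^0 M ≤ LinearMap.ker (contract τ x) := by
  apply exteriorPower_le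
  intro v
  rw [LinearMap.mem_ker, ιMulti_zero_apply]
  exact contract_one τ x

theorem contract_mem_exteriorPower (x : M) {k l : ℕ} (hl : l = k + 1) {y : ExteriorAlgebra R M}
    (hy : y ∈ ⋀[R]^l M) : contract τ x y ∈ ⋀[R]^k M := by
  subst hl
  suffices hle : ⋀[R]^(k + 1) M ≤ (⋀[R]^k M).comap (contract τ x) from Submodule.mem_comap.1 (hle hy)
  clear hy
  induction k with
  | zero =>
    apply exteriorPower_le
    intro v
    rw [Submodule.mem_comap, ιMulti_succ_apply, contract_ι_mul, ιMulti_zero_apply, contract_one,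
      mul_zero, sub_zero]
    refine Submodule.smul_mem _ _ ?_
    rw [← ιMulti_zero_apply (R := R) (M := M) Fin.elim0]
    exact ιMulti_mem_exteriorPower _
  | succ k ih =>
    apply exteriorPower_le
    intro v
    rw [Submodule.mem_comap, ιMulti_succ_apply, contract_ι_mul]
    exact sub_mem (Submodule.smul_mem _ _ (ιMulti_mem_exteriorPower _))
      (ι_mul_mem_exteriorPower _ (Submodule.mem_comap.1 (ih (ιMulti_mem_exteriorPower _))))

end Degrees

/-- The map `(x, y) ↦ x + T y` from `K × P` to `N` is injective; `hPK` includes injectivity of `T`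
on `P`, since `0 ∈ K`. -/
theorem finrank_add_finrank_le_of_disjoint {R A : Type*} [CommRing R] [IsDomain R]
    [IsPrincipalIdealRing R] [AddCommGroup A] [Module R A] {K P N : Submodule R A}
    [Module.Free R N] [Module.Finite R N] [Module.Free R P] [Module.Finite R P] (T : A →ₗ[R] A)
    (hK : K ≤ N) (hP : ∀ y ∈ P, T y ∈ N) (hPK : ∀ y ∈ P, T y ∈ K → y = 0) :
    Module.finrank R K + Module.finrank R P ≤ Module.finrank R N := by
  let K' : Submodule R N := K.comap N.subtype
  have eK : K' ≃ₗ[R] K := Submodule.comapSubtypeEquivOfLe hK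
  let S : K' × P →ₗ[R] N := K'.subtype.coprod
    ((T.domRestrict P).codRestrict _ fun y => hP y y.2)
  have hS : Function.Injective S := by
    refine (injective_iff_map_eq_zero S).2 ?_
    rintro ⟨⟨⟨x, hx⟩, hxK⟩, ⟨y, hy⟩⟩ hxy
    have h1 : x + T y = 0 := congrArg Subtype.val hxy
    have h2 : T y ∈ K := by
      rw [← neg_eq_of_add_eq_zero_right h1]
      exact K.neg_mem hxK
    obtain rfl := hPK y hy h2
    rw [map_zero, add_zero] at h1
    subst h1
    rfl
  have h3 := LinearMap.finrank_le_finrank_of_injective hS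
  rwa [Module.finrank_prod, eK.finrank_eq] at h3

/-! ### The `sl₂` relations and the kernel of the lowering operator. -/

section Lefschetz

variable {R M : Type*} [CommRing R] [AddCommGroup M] [Module R M]
  (τ : LinearMap.BilinForm R M) {n : ℕ} (e f : Fin n → M)

/-- Contraction with the bivector dual to the symplectic form. -/
def lowering : ExteriorAlgebra R M →ₗ[R] ExteriorAlgebra R M :=
  ∑ i, contract τ (f i) ∘ₗ contract τ (e i)

/-- Multiplication by the bivector `∑ eᵢ ∧ fᵢ`. -/
def raising : ExteriorAlgebra R M →ₗ[R] ExteriorAlgebra R M :=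
  ∑ i, LinearMap.mulLeft R (ι R (e i)) ∘ₗ LinearMap.mulLeft R (ι R (f i))

/-- The degree operator, written in a symplectic basis. -/
def euler : ExteriorAlgebra R M →ₗ[R] ExteriorAlgebra R M :=
  ∑ i, (LinearMap.mulLeft R (ι R (f i)) ∘ₗ contract τ (e i) -
    LinearMap.mulLeft R (ι R (e i)) ∘ₗ contract τ (f i))

theorem lowering_apply (y : ExteriorAlgebra R M) :
    lowering τ e f y = ∑ i, contract τ (f i) (contract τ (e i) y) := by
  simp [lowering]

theorem raising_apply (y : ExteriorAlgebra R M) :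
    raising e f y = ∑ i, ι R (e i) * (ι R (f i) * y) := by
  simp [raising]

theorem euler_apply (y : ExteriorAlgebra R M) :
    euler τ e f y = ∑ i, (ι R (f i) * contract τ (e i) y - ι R (e i) * contract τ (f i) y) := by
  simp [euler]

theorem lowering_eq_zero_of_lt_two {k : ℕ} (hk : k < 2) :
    ⋀[R]^k M ≤ LinearMap.ker (lowering τ e f) := by
  intro y hy
  rw [LinearMap.mem_ker, lowering_apply]
  refine Finset.sum_eq_zero fun i _ => ?_
  match k with
  | 0 => rw [LinearMap.mem_ker.1 (contract_eq_zero_of_mem_zero τ (e i) hy), map_zero]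
  | 1 => exact LinearMap.mem_ker.1 (contract_eq_zero_of_mem_zero τ (f i)
      (contract_mem_exteriorPower τ (e i) rfl hy))

theorem lowering_mem {k : ℕ} {y : ExteriorAlgebra R M} (hy : y ∈ ⋀[R]^(k + 2) M) :
    lowering τ e f y ∈ ⋀[R]^k M := by
  rw [lowering_apply]
  refine sum_mem fun i _ => ?_
  have h1 : contract τ (e i) y ∈ ⋀[R]^(k + 1) M := contract_mem_exteriorPower τ (e i) rfl hy
  exact contract_mem_exteriorPower τ (f i) rfl h1

theorem raising_mem {k : ℕ} {y : ExteriorAlgebra R M} (hy : y ∈ ⋀[R]^k M) :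
    raising e f y ∈ ⋀[R]^(k + 2) M := by
  rw [raising_apply]
  exact sum_mem fun i _ => ι_mul_mem_exteriorPower _ (ι_mul_mem_exteriorPower _ hy)

theorem ι_mul_ι_mul_swap (x y : M) (z : ExteriorAlgebra R M) :
    ι R x * (ι R y * z) = -(ι R y * (ι R x * z)) := by
  rw [← mul_assoc, ← mul_assoc, eq_neg_iff_add_eq_zero, ← add_mul, ι_add_mul_swap, zero_mul]

variable {τ e f} (hτ : τ.IsAlt) (h : IsSymplecticBasis τ e f)
include hτ h

/-- The commutator of lowering with `v ∧ ·` is contraction by `τ v`, seen by expanding `v` in the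
symplectic basis. -/
theorem lowering_ι_mul (v : M) (y : ExteriorAlgebra R M) :
    lowering τ e f (ι R v * y) = ι R v * lowering τ e f y + contract τ v y := by
  have hc : contract τ v y =
      ∑ i, (τ v (f i) • contract τ (e i) y - τ v (e i) • contract τ (f i) y) := by
    conv_lhs => rw [← h.sum_eq v]
    simp [contract]
  rw [hc, lowering_apply, lowering_apply, Finset.mul_sum, ← Finset.sum_add_distrib]
  refine Finset.sum_congr rfl fun i _ => ?_
  rw [contract_ι_mul, map_sub, map_smul, contract_ι_mul, ← hτ.neg_eq v (f i), ← hτ.neg_eq v (e i)]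
  module

theorem euler_ι_mul (v : M) (y : ExteriorAlgebra R M) :
    euler τ e f (ι R v * y) = ι R v * y + ι R v * euler τ e f y := by
  have hv : ι R v * y = ∑ i, (τ v (f i) • (ι R (e i) * y) - τ v (e i) • (ι R (f i) * y)) := by
    conv_lhs => rw [← h.sum_eq v]
    simp [Finset.sum_mul, sub_mul]
  conv_rhs => rw [hv]
  rw [euler_apply, euler_apply, Finset.mul_sum, ← Finset.sum_add_distrib]
  refine Finset.sum_congr rfl fun i _ => ?_
  rw [contract_ι_mul, contract_ι_mul, ← hτ.neg_eq v (f i), ← hτ.neg_eq v (e i), mul_sub, mul_sub,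
    mul_sub, ι_mul_ι_mul_swap (f i) v, ι_mul_ι_mul_swap (e i) v, mul_smul_comm, mul_smul_comm]
  module

theorem euler_eq_smul {k : ℕ} {y : ExteriorAlgebra R M} (hy : y ∈ ⋀[R]^k M) :
    euler τ e f y = (k : R) • y := by
  suffices hle : ⋀[R]^k M ≤ LinearMap.ker (euler τ e f - (k : R) • LinearMap.id) by
    simpa [sub_eq_zero] using hle hy
  clear hy
  induction k with
  | zero =>
    apply exteriorPower_le
    intro v
    simp only [Nat.cast_zero, zero_smul, sub_zero, LinearMap.mem_ker, euler_apply,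
      ιMulti_zero_apply, contract_one, mul_zero, Finset.sum_const_zero]
  | succ k ih =>
    apply exteriorPower_le
    intro v
    have h1 := ih (ιMulti_mem_exteriorPower (Matrix.vecTail v))
    simp only [LinearMap.mem_ker, LinearMap.sub_apply, LinearMap.smul_apply, LinearMap.id_apply,
      sub_eq_zero] at h1 ⊢
    rw [ιMulti_succ_apply, euler_ι_mul hτ h, h1, mul_smul_comm]
    push_cast
    module

/-- The `sl₂` relation: the commutator of lowering and raising is `n` minus the degree operator. -/
theorem lowering_raising (y : ExteriorAlgebra R M) :
    lowering τ e f (raising e f y) =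
      raising e f (lowering τ e f y) + (n : R) • y - euler τ e f y := by
  have hn : (n : R) • y = ∑ _i : Fin n, y := by
    simp [Nat.cast_smul_eq_nsmul]
  rw [hn, euler_apply, raising_apply, raising_apply, map_sum, ← Finset.sum_add_distrib,
    ← Finset.sum_sub_distrib]
  refine Finset.sum_congr rfl fun i _ => ?_
  rw [lowering_ι_mul hτ h, lowering_ι_mul hτ h, contract_ι_mul, h.apply_left_right, if_pos rfl,
    mul_add, one_smul]
  abel

theorem lowering_raising_of_mem {k : ℕ} (hk : k ≤ n) {y : ExteriorAlgebra R M}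
    (hy : y ∈ ⋀[R]^k M) : lowering τ e f (raising e f y) =
      raising e f (lowering τ e f y) + ((n - k : ℕ) : R) • y := by
  rw [lowering_raising hτ h, euler_eq_smul hτ h hy, Nat.cast_sub hk]
  module

/-- Moving lowering past `v 0` leaves a contraction by `τ (v 0)`, which kills the orthogonal
remaining factors. -/
theorem lowering_ιMulti_eq_zero {k : ℕ} (v : Fin k → M) (hv : ∀ i j, τ (v i) (v j) = 0) :
    lowering τ e f (ιMulti R k v) = 0 := by
  induction k with
  | zero => exact lowering_eq_zero_of_lt_two τ e f (by omega) (ιMulti_mem_exteriorPower v)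
  | succ k ih =>
    rw [ιMulti_succ_apply, lowering_ι_mul hτ h, ih (Matrix.vecTail v) fun i j => hv _ _,
      contract_ιMulti_eq_zero τ (v 0) (Matrix.vecTail v) fun i => hv _ _, mul_zero, add_zero]

variable [IsDomain R] [CharZero R] [Module.IsTorsionFree R (ExteriorAlgebra R M)]

/-- Applying lowering shows that `z = lowering y` satisfies an equation of the same shape two
degrees down, with a larger positive integer in place of `a`. By induction `z = 0`, leaving `a • y =
0`. Keeping `a` arbitrary is what lets the induction run. -/
theorem eq_zero_of_raising_lowering_add_smul {k : ℕ} (hk : k ≤ n) {a : ℕ} (ha : 0 < a)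
    {y : ExteriorAlgebra R M} (hy : y ∈ ⋀[R]^k M)
    (h0 : raising e f (lowering τ e f y) + (a : R) • y = 0) : y = 0 := by
  have ha' : (a : R) ≠ 0 := by exact_mod_cast ha.ne'
  suffices hz : lowering τ e f y = 0 by
    rw [hz, map_zero, zero_add, smul_eq_zero] at h0
    exact h0.resolve_left ha'
  induction k using Nat.strong_induction_on generalizing a y with
  | _ k ih =>
    match k with
    | 0 => exact lowering_eq_zero_of_lt_two τ e f (by omega) hy
    | 1 => exact lowering_eq_zero_of_lt_two τ e f (by omega) hy
    | k + 2 =>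
      have hz := lowering_mem τ e f hy
      have h1 := congrArg (lowering τ e f) h0
      rw [map_add, map_smul, map_zero, lowering_raising_of_mem hτ h (by omega) hz, add_assoc,
        ← add_smul, ← Nat.cast_add] at h1
      have hb : ((n - k + a : ℕ) : R) ≠ 0 := by
        have : n - k + a ≠ 0 := by omega
        exact_mod_cast this
      have h2 := ih k (by omega) (by omega) (by omega) hz h1 hb
      rw [h2, map_zero, zero_add, smul_eq_zero] at h1
      exact h1.resolve_left hb

theorem eq_zero_of_lowering_raising {k : ℕ} (hk : k < n) {y : ExteriorAlgebra R M}
    (hy : y ∈ ⋀[R]^k M) (h0 : lowering τ e f (raising e f y) = 0) : y = 0 := by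
  rw [lowering_raising_of_mem hτ h hk.le hy] at h0
  exact eq_zero_of_raising_lowering_add_smul hτ h hk.le (by omega) hy h0

theorem finrank_ker_lowering_add_choose_le [IsPrincipalIdealRing R] [Module.Free R M]
    [Module.Finite R M] {k : ℕ} (hk : k < n) :
    Module.finrank R ↥(LinearMap.ker (lowering τ e f) ⊓ ⋀[R]^(k + 2) M) +
      (Module.finrank R M).choose k ≤ (Module.finrank R M).choose (k + 2) := by
  have h3 := finrank_add_finrank_le_of_disjoint (raising e f)
    (K := LinearMap.ker (lowering τ e f) ⊓ ⋀[R]^(k + 2) M) (P := ⋀[R]^k M) (N := ⋀[R]^(k + 2) M)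
    inf_le_right (fun y hy => raising_mem e f hy)
    (fun y hy hy' => eq_zero_of_lowering_raising hτ h hk hy (LinearMap.mem_ker.1 hy'.1))
  rwa [exteriorPower.finrank_eq, exteriorPower.finrank_eq] at h3

end Lefschetz

/-! ### The standard symplectic module over a ring. -/

section StandardForm

variable (R : Type*) [CommRing R] (n : ℕ)

/-- The standard symplectic form on `Rⁿ × Rⁿ`. -/
def standardForm : LinearMap.BilinForm R ((Fin n → R) × (Fin n → R)) :=
  LinearMap.mk₂ R (fun x y => x.1 ⬝ᵥ y.2 - x.2 ⬝ᵥ y.1)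
    (fun x y z => by simp only [Prod.fst_add, Prod.snd_add, add_dotProduct]; ring)
    (fun a x y => by simp only [Prod.smul_fst, Prod.smul_snd, smul_dotProduct, smul_sub])
    (fun x y z => by simp only [Prod.fst_add, Prod.snd_add, dotProduct_add]; ring)
    (fun a x y => by simp only [Prod.smul_fst, Prod.smul_snd, dotProduct_smul, smul_sub])

theorem standardForm_apply (x y : (Fin n → R) × (Fin n → R)) :
    standardForm R n x y = x.1 ⬝ᵥ y.2 - x.2 ⬝ᵥ y.1 := rfl

theorem standardForm_isAlt : (standardForm R n).IsAlt := fun x => by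
  rw [standardForm_apply, dotProduct_comm, sub_self]

theorem isSymplecticBasis_standardForm : IsSymplecticBasis (standardForm R n)
    (fun i => (Pi.single i 1, 0)) (fun i => (0, Pi.single i 1)) where
  apply_left_left i j := by simp [standardForm_apply]
  apply_right_right i j := by simp [standardForm_apply]
  apply_left_right i j := by simp [standardForm_apply, Pi.single_apply, eq_comm]
  sum_eq v := by
    ext j <;> simp [standardForm_apply, Prod.fst_sum, Prod.snd_sum, Finset.sum_apply,
      Pi.single_apply]

end StandardForm

/-! ### Lifting isotropic families from the residue field. -/

section Lifting

variable {F V : Type*} [Field F] [AddCommGroup V] [Module F V]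

theorem exists_dual_family [FiniteDimensional F V] {σ : LinearMap.BilinForm F V}
    (hσ : σ.IsAlt) (hn : σ.Nondegenerate) {k : ℕ} {v : Fin k → V} (hv : LinearIndependent F v) :
    ∃ y : Fin k → V, ∀ i j, σ (v i) (y j) = if i = j then 1 else 0 := by
  obtain ⟨g, hg⟩ := LinearMap.exists_extend (hv.repr : _ →ₗ[F] Fin k →₀ F)
  -- The sign compensates for `toDual` placing `y j` in the first argument of the alternating form.
  refine ⟨fun j => (σ.toDual hn).symm (-(Finsupp.lapply j ∘ₗ g)), fun i j => ?_⟩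
  rw [← hσ.neg_eq, ← LinearMap.BilinForm.toDual_def hn, LinearEquiv.apply_symm_apply]
  have h1 : g (v i) = Finsupp.single i 1 := by
    rw [← hv.repr_eq_single i ⟨v i, Submodule.subset_span ⟨i, rfl⟩⟩ rfl]
    exact LinearMap.congr_fun hg ⟨v i, Submodule.subset_span ⟨i, rfl⟩⟩
  simp [h1, Finsupp.single_apply]

/-- With the tail lifted, any lift `w₀` of `v 0` is corrected by a combination of lifts `Y j` of a
dual family. The linear system for the coefficients has a matrix reducing to the identity, hence
invertible over the local ring, and a right side reducing to zero. The coefficients thus reduce to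
zero, and the corrected vector still lies over `v 0`. -/
theorem exists_isotropic_lift [FiniteDimensional F V] {σ : LinearMap.BilinForm F V}
    (hσ : σ.IsAlt) (hn : σ.Nondegenerate)
    {R M : Type*} [CommRing R] [IsLocalRing R] [Algebra R F] [Module R V] [IsScalarTower R F V]
    [AddCommGroup M] [Module R M] {τ : LinearMap.BilinForm R M} (hτ : τ.IsAlt) (ρ : M →ₗ[R] V)
    (hρ : Function.Surjective ρ) (hρτ : ∀ x y, σ (ρ x) (ρ y) = algebraMap R F (τ x y))
    {k : ℕ} (v : Fin k → V) (hl : LinearIndependent F v) (hv : ∀ i j, σ (v i) (v j) = 0) :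
    ∃ w : Fin k → M, (∀ i, ρ (w i) = v i) ∧ ∀ i j, τ (w i) (w j) = 0 := by
  induction k with
  | zero => exact ⟨Fin.elim0, fun i => i.elim0, fun i => i.elim0⟩
  | succ k ih =>
    have hl' : LinearIndependent F (Fin.tail v) := by
      rw [← Fin.cons_self_tail v, linearIndependent_finCons] at hl
      exact hl.1
    obtain ⟨w, hw, hww⟩ := ih (Fin.tail v) hl' fun i j => hv _ _
    obtain ⟨w₀, hw₀⟩ := hρ (v 0)
    obtain ⟨y, hy⟩ := exists_dual_family hσ hn hl'
    choose Y hY using fun j => hρ (y j)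
    let A : Matrix (Fin k) (Fin k) R := Matrix.of fun i j => τ (w i) (Y j)
    let b : Fin k → R := fun i => τ (w i) w₀
    have hA : A.map (algebraMap R F) = 1 := by
      ext i j
      simp [A, ← hρτ, hw, hY, hy, Matrix.one_apply]
    have hb : algebraMap R F ∘ b = 0 := by
      ext i
      simp only [b, Function.comp_apply, ← hρτ, hw, hw₀, Pi.zero_apply]
      exact hv _ _
    have hdet : IsUnit A.det := by
      refine (IsLocalRing.isUnit_or_isUnit_one_sub_self A.det).resolve_right fun hu => ?_
      have h1 := hu.map (algebraMap R F)
      rw [map_sub, map_one, RingHom.map_det, RingHom.mapMatrix_apply, hA, Matrix.det_one,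
        sub_self] at h1
      exact not_isUnit_zero h1
    let x : Fin k → R := A⁻¹.mulVec b
    have hx : A.mulVec x = b := by
      simp only [x, Matrix.mulVec_mulVec, Matrix.mul_nonsing_inv A hdet, Matrix.one_mulVec]
    have hx0 : ∀ j, algebraMap R F (x j) = 0 := by
      intro j
      have h1 := RingHom.map_mulVec (algebraMap R F) A x j
      rw [hx, hA, Matrix.one_mulVec] at h1
      exact h1.symm.trans (congrFun hb j)
    have hperp (i) : τ (w i) (w₀ - ∑ j, x j • Y j) = 0 := by
      have h1 : ∑ j, τ (w i) (Y j) * x j = τ (w i) w₀ := congrFun hx i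
      rw [map_sub, map_sum, ← h1, sub_eq_zero]
      exact Finset.sum_congr rfl fun j _ => by rw [map_smul, smul_eq_mul, mul_comm]
    refine ⟨Fin.cons (w₀ - ∑ j, x j • Y j) w, fun i => ?_, fun i j => ?_⟩
    · cases i using Fin.cases with
      | zero =>
        have h2 (j) : x j • y j = 0 := by rw [← algebraMap_smul F (x j) (y j), hx0, zero_smul]
        simp [hw₀, hY, h2]
      | succ i => exact hw i
    · cases i using Fin.cases with
      | zero =>
        cases j using Fin.cases with
        | zero => simpa only [Fin.cons_zero] using hτ _
        | succ j => simpa only [Fin.cons_zero, Fin.cons_succ] using hτ.isRefl _ _ (hperp j)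
      | succ i =>
        cases j using Fin.cases with
        | zero => simpa only [Fin.cons_zero, Fin.cons_succ] using hperp i
        | succ j => simpa only [Fin.cons_succ] using hww i j

end Lifting

/-! ### Upper bound for the dimension, through Witt vectors. -/

section UpperBound

/-- The images of an `R`-basis of `K` generate the span; reduction may lower the dimension but
cannot raise it. -/
theorem finrank_span_image_le {R F A B : Type*} [CommRing R] [IsDomain R] [IsPrincipalIdealRing R]
    [Field F] [Algebra R F] [AddCommGroup A] [Module R A] [AddCommGroup B] [Module F B]
    [Module R B] [IsScalarTower R F B] {K N : Submodule R A} [Module.Free R N] [Module.Finite R N]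
    (hK : K ≤ N) (g : A →ₗ[R] B) :
    FiniteDimensional F (Submodule.span F (g '' K)) ∧
      Module.finrank F (Submodule.span F (g '' K)) ≤ Module.finrank R K := by
  let K' : Submodule R N := K.comap N.subtype
  have eK : K' ≃ₗ[R] K := Submodule.comapSubtypeEquivOfLe hK
  have : Module.Free R K := Module.Free.of_equiv eK
  have : Module.Finite R K := Module.Finite.equiv eK
  let b := Module.finBasis R K
  have hle : Submodule.span F (g '' K) ≤ Submodule.span F (Set.range fun i => g (b i)) := by
    rw [Submodule.span_le]
    rintro _ ⟨x, hx, rfl⟩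
    have h1 := b.sum_repr ⟨x, hx⟩
    have h2 := congrArg (fun z : K => g z) h1
    simp only [Submodule.coe_sum, Submodule.coe_smul, map_sum, map_smul] at h2
    rw [← h2]
    refine sum_mem fun i _ => ?_
    rw [← algebraMap_smul F]
    exact Submodule.smul_mem _ _ (Submodule.subset_span ⟨i, rfl⟩)
  have : FiniteDimensional F (Submodule.span F (Set.range fun i => g (b i))) :=
    FiniteDimensional.span_of_finite F (Set.finite_range _)
  exact ⟨Submodule.finiteDimensional_of_le hle, (Submodule.finrank_mono hle).trans
    ((finrank_range_le_card (R := F) _).trans (by simp))⟩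

theorem isTorsionFree_exteriorAlgebra (R M : Type*) [CommRing R] [IsDomain R] [AddCommGroup M]
    [Module R M] [Module.Free R M] : Module.IsTorsionFree R (ExteriorAlgebra R M) := by
  let b := Module.Free.chooseBasis R M
  -- The basis of the exterior algebra uses ordered products, so some order on the indices is
  -- chosen.
  let _ : LinearOrder (Module.Free.ChooseBasisIndex R M) :=
    IsWellOrder.linearOrder WellOrderingRel
  have : Module.Free R (ExteriorAlgebra R M) := Module.Free.of_basis b.ExteriorAlgebra
  infer_instance

variable {F V : Type*} [Field F] [AddCommGroup V] [Module F V]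

/-- The ring homomorphism of exterior algebras induced by a map of modules over a base change. -/
def reduction {R M : Type*} [CommRing R] [Algebra R F] [Module R V] [IsScalarTower R F V]
    [AddCommGroup M] [Module R M] (ρ : M →ₗ[R] V) :
    ExteriorAlgebra R M →ₐ[R] ExteriorAlgebra F V :=
  ExteriorAlgebra.lift R ⟨(ι F : V →ₗ[F] ExteriorAlgebra F V).restrictScalars R ∘ₗ ρ,
    fun m => ι_sq_zero (ρ m)⟩

theorem reduction_ιMulti {R M : Type*} [CommRing R] [Algebra R F] [Module R V]
    [IsScalarTower R F V] [AddCommGroup M] [Module R M] (ρ : M →ₗ[R] V) {k : ℕ} (w : Fin k → M) :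
    reduction (F := F) ρ (ιMulti R k w) = ιMulti F k fun i => ρ (w i) := by
  have hι (m : M) : reduction (F := F) ρ (ι R m) = ι F (ρ m) :=
    ExteriorAlgebra.lift_ι_apply R _ _ m
  simp [ιMulti_apply, map_list_prod, List.map_ofFn, Function.comp_def, hι]

variable [FiniteDimensional F V]

theorem finrank_isotropicSpan_add_choose_le_of_algebra {σ : LinearMap.BilinForm F V}
    (hσ : σ.IsAlt) (hn : σ.Nondegenerate) {n : ℕ} (hV : Module.finrank F V = 2 * n)
    (R : Type*) [CommRing R] [IsDomain R] [IsPrincipalIdealRing R] [IsLocalRing R] [CharZero R]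
    [Algebra R F] [Module R V] [IsScalarTower R F V]
    (hR : Function.Surjective (algebraMap R F)) {k : ℕ} (hk : k < n) :
    Module.finrank F (isotropicSpan σ ⊤ (k + 2)) + (2 * n).choose k ≤ (2 * n).choose (k + 2) := by
  obtain ⟨e, f, h⟩ := exists_isSymplecticBasis hσ hn hV
  let ρ : (Fin n → R) × (Fin n → R) →ₗ[R] V :=
    (Fintype.linearCombination R e).coprod (Fintype.linearCombination R f)
  have hρ (x) : ρ x = ∑ i, (algebraMap R F (x.1 i) • e i + algebraMap R F (x.2 i) • f i) := by
    simp [ρ, Fintype.linearCombination_apply, Finset.sum_add_distrib]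
  have hsurj : Function.Surjective ρ := by
    intro v
    choose a ha using fun i => hR (σ v (f i))
    choose b hb using fun i => hR (-σ v (e i))
    refine ⟨(a, b), ?_⟩
    rw [hρ]
    conv_rhs => rw [← h.sum_eq v]
    exact Finset.sum_congr rfl fun i _ => by rw [ha, hb]; module
  have hfe (i j) : σ (f i) (e j) = if i = j then -1 else 0 := by
    rw [← hσ.neg_eq, h.apply_left_right]
    simp [eq_comm, apply_ite]
  have hρτ (x y) : σ (ρ x) (ρ y) = algebraMap R F (standardForm R n x y) := by
    simp [hρ, standardForm_apply, dotProduct, LinearMap.sum_apply, h.apply_left_left,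
      h.apply_right_right, h.apply_left_right, hfe, Finset.sum_add_distrib, sub_eq_add_neg,
      Algebra.smul_def]
  have := isTorsionFree_exteriorAlgebra R ((Fin n → R) × (Fin n → R))
  have hb := isSymplecticBasis_standardForm R n
  have hM : Module.finrank R ((Fin n → R) × (Fin n → R)) = 2 * n := by
    rw [Module.finrank_prod, Module.finrank_fin_fun, two_mul]
  have h1 := finrank_ker_lowering_add_choose_le (standardForm_isAlt R n) hb hk
  rw [hM] at h1
  set K := LinearMap.ker (lowering (standardForm R n) (fun i => (Pi.single i 1, 0))
    (fun i => (0, Pi.single i 1))) ⊓ ⋀[R]^(k + 2) ((Fin n → R) × (Fin n → R)) with hK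
  obtain ⟨h2, h3⟩ := finrank_span_image_le (F := F) (K := K)
    (N := ⋀[R]^(k + 2) ((Fin n → R) × (Fin n → R))) inf_le_right
    (reduction (F := F) ρ).toLinearMap
  -- The wedge of a lifted frame lies in the kernel over `R` and reduces to the wedge of the
  -- original frame.
  have h4 : isotropicSpan σ ⊤ (k + 2) ≤
      Submodule.span F ((reduction (F := F) ρ).toLinearMap '' K) := by
    apply isotropicSpan_top_le
    intro v hl hv
    obtain ⟨w, hw, hww⟩ := exists_isotropic_lift hσ hn (standardForm_isAlt R n) ρ hsurj hρτ v hl hv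
    refine Submodule.subset_span ⟨ιMulti R (k + 2) w, ⟨?_, ιMulti_mem_exteriorPower w⟩, ?_⟩
    · exact lowering_ιMulti_eq_zero (standardForm_isAlt R n) hb w hww
    · rw [AlgHom.toLinearMap_apply, reduction_ιMulti]
      simp only [hw]
  have h5 := Submodule.finrank_mono h4
  omega

/-- A prime characteristic would survive in the residue field, hence equal `p`; but `p ≠ 0` in the
Witt vectors. -/
theorem charZero_wittVector (p : ℕ) [Fact p.Prime] (F : Type*) [Field F] [CharP F p] :
    CharZero (WittVector p F) := by
  obtain ⟨q, hq⟩ := CharP.exists (WittVector p F)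
  rcases CharP.char_is_prime_or_zero (WittVector p F) q with hq' | rfl
  · have h0 : (q : WittVector p F) = 0 := CharP.cast_eq_zero _ q
    have h1 := congrArg WittVector.constantCoeff h0
    rw [map_natCast, map_zero, CharP.cast_eq_zero_iff F p,
      Nat.prime_dvd_prime_iff_eq Fact.out hq'] at h1
    subst h1
    exact absurd h0 (WittVector.p_nonzero p F)
  · exact CharP.charP_to_charZero _

theorem finrank_isotropicSpan_add_chooseSubTwo_le [Finite F] {σ : LinearMap.BilinForm F V}
    (hσ : σ.IsAlt) (hn : σ.Nondegenerate) {n : ℕ} (hV : Module.finrank F V = 2 * n) {k : ℕ}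
    (hk : k ≤ n) :
    Module.finrank F (isotropicSpan σ ⊤ k) + chooseSubTwo (2 * n) k ≤ (2 * n).choose k := by
  by_cases hk2 : k < 2
  -- Below degree two nothing is subtracted, and the full exterior power is the bound.
  · have h0 : chooseSubTwo (2 * n) k = 0 := by interval_cases k <;> rfl
    rw [h0, add_zero, ← hV, ← exteriorPower.finrank_eq]
    exact Submodule.finrank_mono (isotropicSpan_le_exteriorPower σ ⊤ k)
  · obtain ⟨k, rfl⟩ : ∃ j, k = j + 2 := ⟨k - 2, by omega⟩
    obtain ⟨p, hp⟩ := CharP.exists F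
    have : Fact p.Prime := ⟨CharP.char_is_prime F p⟩
    have := charZero_wittVector p F
    let _ : Algebra (WittVector p F) F := WittVector.constantCoeff.toAlgebra
    let _ : Module (WittVector p F) V := Module.compHom V (algebraMap (WittVector p F) F)
    have : IsScalarTower (WittVector p F) F V := IsScalarTower.of_algebraMap_smul fun _ _ => rfl
    exact finrank_isotropicSpan_add_choose_le_of_algebra hσ hn hV (WittVector p F)
      -- Teichmüller representatives show that the residue map is onto.
      (fun x => ⟨WittVector.teichmuller p x, WittVector.teichmuller_coeff_zero p x⟩) (by omega)

end UpperBound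

end SymplecticGrassmann

open SymplecticGrassmann in
theorem mainTheorem4 {F V : Type*} [Field F] [Fintype F] [AddCommGroup V] [Module F V]
    [FiniteDimensional F V] (σ : LinearMap.BilinForm F V) (hσ_alt : σ.IsAlt)
    (hσ_nondeg : σ.Nondegenerate) (n k : ℕ) (hV : Module.finrank F V = 2 * n)
    (hk : 1 ≤ k) (hkn : k ≤ n) :
    (∃ (N : ℕ) (C : Submodule F (Fin N → F)),
      SymplecticGrassmann.IsSymplecticGrassmannCode σ k C) ∧
    ∀ (N : ℕ) (C : Submodule F (Fin N → F)),
      SymplecticGrassmann.IsSymplecticGrassmannCode σ k C →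
        N = (SymplecticGrassmann.symplecticGrassmannian σ k).ncard ∧
        N = (SymplecticGrassmann.pluckerImage σ k).ncard ∧
        (N : ℚ) = ∏ i ∈ Finset.range k,
          ((Fintype.card F : ℚ) ^ (2 * n - 2 * i) - 1) / ((Fintype.card F : ℚ) ^ (i + 1) - 1) ∧
        Module.finrank F C =
          Module.finrank F
            (SymplecticGrassmann.linearSpan (SymplecticGrassmann.pluckerImage σ k)) ∧
        (Module.finrank F C : ℤ) =
          (SymplecticGrassmann.binom (2 * n) (k : ℤ) : ℤ) -
            (SymplecticGrassmann.binom (2 * n) ((k : ℤ) - 2) : ℤ) := by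
  have hfin : Finite V := Module.finite_of_finite F
  have hncard : (pluckerImage σ k).ncard = (symplecticGrassmannian σ k).ncard :=
    Set.ncard_image_of_injective _ (plucker_injective k)
  refine ⟨exists_isCodeOf ((Set.toFinite (symplecticGrassmannian σ k)).image _), fun N C hC => ?_⟩
  have hN : N = (pluckerImage σ k).ncard := IsCodeOf.length_eq hC
  have hdim := IsCodeOf.finrank_eq hC
  refine ⟨hN.trans hncard, hN, ?_, hdim, ?_⟩
  · rw [hN, hncard]
    exact ncard_symplecticGrassmannian hσ_alt hσ_nondeg hV hkn
  · have h1 := choose_le_finrank_isotropicSpan hσ_alt hσ_nondeg n ⊤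
      (nondegenerateOn_top hσ_nondeg) (by rw [finrank_top, hV]) k (by omega)
    have h2 := finrank_isotropicSpan_add_chooseSubTwo_le hσ_alt hσ_nondeg hV hkn
    have h3 : binom (2 * n) (k : ℤ) = (2 * n).choose k := by simp [binom]
    rw [hdim, finrank_linearSpan_pluckerImage, binom_sub_two, h3]
    omega
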